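/- Let $\lambda$ be a meromorphic function on $\mathbb{C}$ with a simple pole at $s=0$ and no other singularities. For $n\ge 1$ let $\mathcal{O}(\mathbb{C}^n)$ be the space of entire functions on $\mathbb{C}^n$, with $\mathfrak{S}_n$ acting by permutation of the variables, and let $\mathcal{S}=\bigoplus_{n\ge 0}\mathcal{O}(\mathbb{C}^n)^{\mathfrak{S}_n}$ be the graded algebra with the symmetric shuffle multiplication $$(F\star F')(s_1,\dots,s_{k+l})=\sum_{w\in Sh(k,l)} w\Bigl(F(s_1,\dots,s_k)\,F'(s_{k+1},\dots,s_{k+l})\prod_{1\le i\le k<j\le k+l}\lambda(s_i-s_j)\Bigr),$$ where $Sh(k,l)\subset\mathfrak{S}_{k+l}$ is the set of permutations increasing on $\{1,\dots,k\}$ and on $\{k+1,\dots,k+l\}$, and $(wG)(s_1,\dots,s_{k+l})=G(s_{w(1)},\dots,s_{w(k+l)})$ (the right-hand side, defined where the $s_i$ are distinct, extends to an entire function). The completed bar complex $\mathbf{B}_n^\bullet$ of $\mathcal{S}$ has the terms $$\mathbf{B}_n^{-p}=\bigoplus_{i_1+\dots+i_p=n,\ i_\nu\ge 1}\mathcal{O}(\mathbb{C}^n)^{\mathfrak{S}_{i_1}\times\dots\times\mathfrak{S}_{i_p}}=\bigoplus_{i_1+\dots+i_p=n,\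 i_\nu\ge 1}\mathcal{S}_{i_1}\widehat\otimes\cdots\widehat\otimes\,\mathcal{S}_{i_p},\qquad 1\le p\le n,$$ and the differential $d(f_1\otimes\dots\otimes f_p)=\sum_{\nu=1}^{p-1}(-1)^{\nu-1}f_1\otimes\dots\otimes(f_\nu\star f_{\nu+1})\otimes\dots\otimes f_p$ (extended to the completed tensor products by the same formula for $\star$ applied in the variables of the $\nu$-th and $(\nu+1)$-st blocks). It is linear over $\mathcal{O}(\mathbb{C}^n)^{\mathfrak{S}_n}$, the ring of holomorphic functions on the symmetric power $\mathrm{Sym}^n(\mathbb{C})=\mathbb{C}^n/\mathfrak{S}_n$. For $T\in\mathrm{Sym}^n(\mathbb{C})$ let $\mathcal{B}^\bullet_{n,T}=\mathbf{B}_n^\bullet\otimes_{\mathcal{O}(\mathbb{C}^n)^{\mathfrak{S}_n}}\mathcal{O}_T$ be the fibre at $T$, where $\mathcal{O}_T=\mathbb{C}$ is an algebra over $\mathcal{O}(\mathbb{C}^n)^{\mathfrak{S}_n}$ through evaluation at $T$. A wheel for $\lambda$ is a sequence $(s_1,\dots,s_m)$, $m\ge 2$, of distinct complex numbers such that $$\lambda(s_2-s_1)=\lambda(s_3-s_2)=\dots=\lambda(s_m-s_{m-1})=\lambda(s_1-s_m)=0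 .$$ Theorem. Let $n\ge 1$ and let $T=\{s_1^0,\dots,s_n^0\}$ be an unordered collection of $n$ distinct complex numbers, such that no subset of $T$, in any order, is a wheel for $\lambda$. Then $\mathcal{B}^\bullet_{n,T}$ is exact everywhere except at the leftmost term $\mathcal{B}^{-n}_{n,T}$, where the cohomology (that is, the kernel of $\mathcal{B}^{-n}_{n,T}\to\mathcal{B}^{-n+1}_{n,T}$, with $\mathcal{B}^{0}_{n,T}=0$) has dimension $1$ over $\mathbb{C}$. -/

import Mathlib

namespace ShuffleBar

open Filter Topology Metric
open scoped TensorProduct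

/-- An ordered decomposition `n = i₁ + ⋯ + i_p` into positive parts, encoded as a weakly increasing
surjection `c : Fin n → Fin p`: the fibre of `c` over `ν` is the `ν`-th block of consecutive
indices, and `i_ν ≥ 1` is its size. -/
abbrev OrdComp (n p : ℕ) : Type :=
  {c : Fin n → Fin p // Monotone c ∧ Function.Surjective c}

noncomputable instance (n p : ℕ) : Fintype (OrdComp n p) := Fintype.ofFinite _

namespace OrdComp
variable {n p : ℕ}
/-- The decomposition in which the (consecutive) blocks `ν` and `ν + 1` are joined into one block:
`ν.predAbove` is the weakly increasing surjection that hits `ν` twice. -/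
def merge (c : OrdComp n (p + 1)) (ν : Fin p) : OrdComp n p :=
  ⟨fun i => ν.predAbove (c.1 i), (Fin.predAbove_right_monotone ν).comp c.2.1,
    (Fin.predAbove_surjective ν).comp c.2.2⟩

/-- The subgroup `𝔖_{i₁} × ⋯ × 𝔖_{i_p}` of `𝔖_n`: permutations preserving every block. -/
def young (c : OrdComp n p) : Finset (Equiv.Perm (Fin n)) :=
  Finset.univ.filter fun w => ∀ i, c.1 (w i) = c.1 i

/-- The `(i_ν, i_{ν+1})`-shuffles, acting on the indices of the blocks `ν` and `ν + 1`: permutations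
that preserve the joined block and each other block, and are increasing on every block of `c`
(hence the identity outside the joined block). -/
def shuffles (c : OrdComp n (p + 1)) (ν : Fin p) : Finset (Equiv.Perm (Fin n)) :=
  (c.merge ν).young.filter fun w => ∀ i j, i < j → c.1 i = c.1 j → w i < w j

/-- Pairs of indices `(i, j)` with `i` in block `ν` and `j` in block `ν + 1`. -/
def crossPairs (c : OrdComp n (p + 1)) (ν : Fin p) : Finset (Fin n × Fin n) :=
  Finset.univ.filter fun x => c.1 x.1 = ν.castSucc ∧ c.1 x.2 = ν.succ

end OrdComp

/-- The ring `𝒪(ℂⁿ)^{𝔖_n}` of symmetric entire functions on `ℂⁿ`, that is the ring of holomorphic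
functions on `Symⁿ(ℂ)`. -/
def symEntire (n : ℕ) : Subalgebra ℂ ((Fin n → ℂ) → ℂ) where
  carrier := {f | Differentiable ℂ f ∧
    ∀ (w : Equiv.Perm (Fin n)) (s : Fin n → ℂ), f (fun i => s (w i)) = f s}
  mul_mem' := fun ha hb => ⟨ha.1.mul hb.1, fun w s => by simp [ha.2 w s, hb.2 w s]⟩
  add_mem' := fun ha hb => ⟨ha.1.add hb.1, fun w s => by simp [ha.2 w s, hb.2 w s]⟩
  algebraMap_mem' := fun r => ⟨differentiable_const r, fun w s => rfl⟩

/-- The `𝒪(ℂⁿ)^{𝔖_n}`-module `𝒪(ℂⁿ)^{𝔖_{i₁} × ⋯ × 𝔖_{i_p}}`, i.e. the completed tensor product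
`𝒮_{i₁} ⊗̂ ⋯ ⊗̂ 𝒮_{i_p}` where `𝒮_i = 𝒪(ℂ^i)^{𝔖_i}` is the degree `i` part of the symmetric shuffle
algebra of entire functions. -/
def blockEntire {n p : ℕ} (c : OrdComp n p) : Submodule (symEntire n) ((Fin n → ℂ) → ℂ) where
  carrier := {F | Differentiable ℂ F ∧
    ∀ w ∈ c.young, ∀ s : Fin n → ℂ, F (fun i => s (w i)) = F s}
  add_mem' := fun ha hb => ⟨ha.1.add hb.1, fun w hw s => by simp [ha.2 w hw s, hb.2 w hw s]⟩
  zero_mem' := ⟨differentiable_const 0, fun _ _ _ => rfl⟩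
  smul_mem' := fun r F hF => ⟨r.2.1.mul hF.1, fun w hw s => by
    have h1 := r.2.2 w s
    have h2 := hF.2 w hw s
    change r.1 _ * F _ = r.1 _ * F _
    rw [h1, h2]⟩

noncomputable instance (n : ℕ) : Module (symEntire n) ((Fin n → ℂ) → ℂ) := inferInstance

noncomputable instance {n p : ℕ} (c : OrdComp n p) : AddCommGroup (blockEntire c) := inferInstance

noncomputable instance {n p : ℕ} (c : OrdComp n p) : Module (symEntire n) (blockEntire c) :=
  Submodule.module _

noncomputable instance {n p : ℕ} (c : OrdComp n p) : SMul (symEntire n) (blockEntire c) :=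
  Module.toDistribMulAction.toSMul

theorem blockEntire_continuous {n p : ℕ} {c : OrdComp n p} (F : blockEntire c) :
    Continuous F.1 := F.2.1.continuous

/-- The term of cohomological degree `-p` of the completed bar complex in weight `n`: the (finite)
direct sum of the modules `𝒪(ℂⁿ)^{𝔖_{i₁} × ⋯ × 𝔖_{i_p}}` over all `i₁ + ⋯ + i_p = n`, `i_ν ≥ 1`. -/
abbrev barTerm (n p : ℕ) : Type := (c : OrdComp n p) → blockEntire c

/-- `lam` is a meromorphic function on `ℂ` with a simple pole at `0` and no other singularities.
The value which the Lean function `lam` takes at `0` is irrelevant. -/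
def HasOnlySimplePoleAtZero (lam : ℂ → ℂ) : Prop :=
  (∀ z, z ≠ 0 → AnalyticAt ℂ lam z) ∧ MeromorphicAt lam 0 ∧ meromorphicOrderAt lam 0 = -1

/-- The function `w(F · ∏ lam(s_i - s_j))`, with `i` in block `ν` and `j` in block `ν + 1`. -/
noncomputable def shuffleTerm {n p : ℕ} (lam : ℂ → ℂ) (c : OrdComp n (p + 1)) (ν : Fin p)
    (F : (Fin n → ℂ) → ℂ) (s : Fin n → ℂ) (w : Equiv.Perm (Fin n)) : ℂ :=
  F (fun i => s (w i)) * ∏ x ∈ c.crossPairs ν, lam (s (w x.1) - s (w x.2))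

/-- The symmetric shuffle product of the tensor factors `ν` and `ν + 1` of `F`, a meromorphic
function on `ℂⁿ` given by this formula away from the diagonals: for `F = F₁ ⊗ ⋯ ⊗ F_p` it is
`F₁ ⊗ ⋯ ⊗ (F_ν ⋆ F_{ν+1}) ⊗ ⋯ ⊗ F_p`, where
`(F ⋆ F')(s) = ∑_{w ∈ Sh(k,l)} w(F(s₁,…,s_k) F'(s_{k+1},…,s_{k+l}) ∏_{i ≤ k < j} lam(s_i - s_j))`. -/
noncomputable def shuffleSum {n p : ℕ} (lam : ℂ → ℂ) (c : OrdComp n (p + 1)) (ν : Fin p)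
    (F : (Fin n → ℂ) → ℂ) (s : Fin n → ℂ) : ℂ :=
  ∑ w ∈ c.shuffles ν, shuffleTerm lam c ν F s w

theorem exists_entire_numerator {lam : ℂ → ℂ} (h : HasOnlySimplePoleAtZero lam) :
    ∃ mu : ℂ → ℂ, Differentiable ℂ mu ∧ ∀ z, z ≠ 0 → lam z = mu z / z := by
  obtain ⟨h1, h2, h3⟩ := h
  obtain ⟨g, hg, -, hgl⟩ := (meromorphicOrderAt_eq_int_iff (n := -1) h2).1 (by simpa using h3)
  refine ⟨fun z => if z = 0 then g 0 else z * lam z, fun z => ?_, fun z hz => ?_⟩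
  · by_cases hz : z = 0
    · subst hz
      refine hg.differentiableAt.congr_of_eventuallyEq ?_
      rw [eventually_nhdsWithin_iff] at hgl
      filter_upwards [hgl] with z hz
      split_ifs with h0
      · rw [h0]
      · rw [hz h0]; simp; field_simp
    · have : DifferentiableAt ℂ (fun z => z * lam z) z :=
        differentiableAt_id.mul (h1 z hz).differentiableAt
      refine this.congr_of_eventuallyEq ?_
      filter_upwards [isOpen_ne.mem_nhds hz] with y hy
      exact if_neg hy
  · simp [hz]

theorem eventually_sep {n : ℕ} (s v : Fin n → ℂ) :
    ∀ᶠ e : ℂ in 𝓝[≠] 0, ∀ i j, v i ≠ v j → s i + e * v i ≠ s j + e * v j := by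
  rw [eventually_all]; intro i
  rw [eventually_all]; intro j
  by_cases hv : v i = v j
  · simp [hv]
  have hv' : v i - v j ≠ 0 := sub_ne_zero.2 hv
  set a := (s j - s i) / (v i - v j) with ha
  have : ∀ᶠ e : ℂ in 𝓝[≠] 0, e ≠ a := by
    by_cases h : a = 0
    · rw [h]; exact self_mem_nhdsWithin
    · exact nhdsWithin_le_nhds (isOpen_ne.mem_nhds (Ne.symm h))
  filter_upwards [this] with e he _ heq
  apply he
  rw [ha, eq_div_iff hv']
  linear_combination heq

theorem eq_of_eq_along {n : ℕ} {F G : (Fin n → ℂ) → ℂ} (hF : Continuous F) (hG : Continuous G)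
    (s v : Fin n → ℂ) (h : ∀ᶠ e : ℂ in 𝓝[≠] 0,
      F (fun i => s i + e * v i) = G (fun i => s i + e * v i)) : F s = G s := by
  have t : ∀ {H : (Fin n → ℂ) → ℂ}, Continuous H →
      Tendsto (fun e : ℂ => H (fun i => s i + e * v i)) (𝓝[≠] 0) (𝓝 (H s)) := by
    intro H hH
    have hc : Continuous (fun e : ℂ => H (fun i => s i + e * v i)) :=
      hH.comp (by fun_prop)
    have := hc.tendsto 0
    simp only [zero_mul, add_zero] at this
    exact this.mono_left nhdsWithin_le_nhds
  exact tendsto_nhds_unique_of_eventuallyEq (t hF) (t hG) h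

theorem eq_of_eq_on_injective {n : ℕ} {F G : (Fin n → ℂ) → ℂ} (hF : Continuous F)
    (hG : Continuous G) (h : ∀ s : Fin n → ℂ, Function.Injective s → F s = G s) : F = G := by
  funext s
  refine eq_of_eq_along hF hG s (fun i => (i : ℕ)) ?_
  filter_upwards [eventually_sep s (fun i => ((i : ℕ) : ℂ))] with e he
  refine h _ fun i j hij => ?_
  by_contra hne
  exact he i j (by simpa [Fin.val_inj] using hne) hij
/-- Division of an entire function vanishing on a hyperplane by the equation of the hyperplane. -/
theorem exists_entire_div {n : ℕ} {f : (Fin n → ℂ) → ℂ} (hf : Differentiable ℂ f)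
    (l : (Fin n → ℂ) →L[ℂ] ℂ) (v : Fin n → ℂ) (hv : l v = 1)
    (h0 : ∀ x, l x = 0 → f x = 0) :
    ∃ q : (Fin n → ℂ) → ℂ, Differentiable ℂ q ∧ ∀ x, f x = l x * q x := by
  set g : (Fin n → ℂ) → ℂ → ℂ := fun x z => f (x - l x • v + z • v) with hg
  have hgd : ∀ x, Differentiable ℂ (g x) := fun x => by
    apply hf.comp; fun_prop
  have hg0 : ∀ x, g x 0 = 0 := fun x => by
    apply h0; simp [hv]
  set q : (Fin n → ℂ) → ℂ := fun x => dslope (g x) 0 (l x) with hq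
  have hmul : ∀ x, f x = l x * q x := by
    intro x
    have := sub_smul_dslope (g x) 0 (l x)
    simp only [sub_zero, hg0, smul_eq_mul] at this
    rw [hq]; simp only; rw [this]; simp [hg]
  have hqo : ∀ x, l x ≠ 0 → DifferentiableAt ℂ q x := by
    intro x hx
    have h1 : DifferentiableAt ℂ (fun y => f y * (l y)⁻¹) x :=
      (hf x).mul (l.differentiableAt.inv hx)
    refine h1.congr_of_eventuallyEq ?_
    filter_upwards [l.continuous.continuousAt.eventually_ne hx] with y hy
    rw [hmul y]; field_simp
  have hqv : ∀ x z, q (x + z • v) = dslope (g x) 0 (l x + z) := by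
    intro x z
    have : g (x + z • v) = g x := by
      funext w; simp only [hg, map_add, map_smul, hv, smul_eq_mul, mul_one]
      congr 1; module
    simp only [hq, this]; simp [hv]
  have havg : ∀ x R, q x = (2 * Real.pi)⁻¹ • ∫ θ in (0:ℝ)..2 * Real.pi,
      q (x + circleMap 0 R θ • v) := by
    intro x R
    have hd : Differentiable ℂ (fun z : ℂ => q (x + z • v)) := by
      simp only [hqv]
      have : Differentiable ℂ (dslope (g x) 0) := by
        rw [← differentiableOn_univ, Complex.differentiableOn_dslope univ_mem]
        exact (hgd x).differentiableOn
      exact this.comp (by fun_prop)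
    have := (hd.diffContOnCl (s := ball 0 |R|)).circleAverage
    rw [Real.circleAverage_def] at this
    simpa using this.symm
  refine ⟨q, fun x₀ => ?_, hmul⟩
  set R : ℝ := ‖l x₀‖ + 1 with hR
  have hRpos : 0 < R := by positivity
  have hfun : q = fun x => (2 * Real.pi)⁻¹ • ∫ θ in (0:ℝ)..2 * Real.pi,
      q (x + circleMap 0 R θ • v) := funext fun x => havg x R
  set K : Set (Fin n → ℂ) := (fun z : ℂ => x₀ + z • v) '' sphere 0 R with hK
  have hKc : IsCompact K := (isCompact_sphere 0 R).image (by fun_prop)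
  set U : Set (Fin n → ℂ) := {x | l x ≠ 0} with hU
  have hUo : IsOpen U := isOpen_ne_fun l.continuous continuous_const
  have hKU : K ⊆ U := by
    rintro _ ⟨z, hz, rfl⟩ h
    simp only [map_add, map_smul, hv, smul_eq_mul, mul_one] at h
    have hz' : ‖z‖ = R := by simpa using hz
    have : l x₀ = -z := by linear_combination h
    rw [hR, this, norm_neg] at hz'
    linarith
  obtain ⟨δ, hδ, hδU⟩ := hKc.exists_cthickening_subset_open hUo hKU
  have hCc : IsCompact (cthickening δ K) := hKc.cthickening
  obtain ⟨M, hM⟩ := hCc.exists_bound_of_continuousOn (f := q)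
    (fun y hy => (hqo y (hδU hy)).continuousAt.continuousWithinAt)
  have hmemK : ∀ θ : ℝ, x₀ + circleMap 0 R θ • v ∈ K := fun θ =>
    ⟨_, circleMap_mem_sphere 0 hRpos.le θ, rfl⟩
  have hball : ∀ x ∈ ball x₀ (δ / 2), ∀ θ : ℝ,
      ball (x + circleMap 0 R θ • v) (δ / 2) ⊆ cthickening δ K := by
    intro x hx θ y hy
    refine mem_cthickening_of_dist_le y _ δ K (hmemK θ) ?_
    have h1 : dist (x + circleMap 0 R θ • v) (x₀ + circleMap 0 R θ • v) = dist x x₀ := by simp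
    have := dist_triangle y (x + circleMap 0 R θ • v) (x₀ + circleMap 0 R θ • v)
    rw [mem_ball] at hx hy
    linarith
  have hdiff : ∀ x ∈ ball x₀ (δ / 2), ∀ θ : ℝ,
      DifferentiableAt ℂ q (x + circleMap 0 R θ • v) := fun x hx θ =>
    hqo _ (hδU (hball x hx θ (mem_ball_self (by positivity))))
  have hbd : ∀ x ∈ ball x₀ (δ / 2), ∀ θ : ℝ,
      ‖fderiv ℂ q (x + circleMap 0 R θ • v)‖ ≤ (2 * M) / (δ / 2) := by
    intro x hx θ
    refine Complex.norm_fderiv_le_div_of_mapsTo_ball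
      (fun y hy => (hqo y (hδU (hball x hx θ hy))).differentiableWithinAt) ?_ (by positivity)
    intro y hy
    rw [mem_closedBall, dist_eq_norm]
    have h1 := hM y (hball x hx θ hy)
    have h2 := hM _ (hball x hx θ (mem_ball_self (by positivity)))
    exact (norm_sub_le _ _).trans (by linarith)
  have hcont : ∀ x ∈ ball x₀ (δ / 2), Continuous fun θ : ℝ => q (x + circleMap 0 R θ • v) := by
    intro x hx
    rw [continuous_iff_continuousAt]
    intro θ
    exact ContinuousAt.comp (f := fun θ : ℝ => x + circleMap 0 R θ • v) (g := q)
      (hdiff x hx θ).continuousAt (by fun_prop)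
  have key := intervalIntegral.hasFDerivAt_integral_of_dominated_of_fderiv_le
    (𝕜 := ℂ) (μ := MeasureTheory.volume) (a := 0) (b := 2 * Real.pi)
    (F := fun x θ => q (x + circleMap 0 R θ • v))
    (F' := fun x θ => fderiv ℂ q (x + circleMap 0 R θ • v)) (x₀ := x₀)
    (bound := fun _ => (2 * M) / (δ / 2)) (s := ball x₀ (δ / 2))
    (ball_mem_nhds _ (by positivity))
    (by
      filter_upwards [ball_mem_nhds x₀ (show 0 < δ / 2 by positivity)] with x hx
      exact (hcont x hx).aestronglyMeasurable)
    ((hcont x₀ (mem_ball_self (by positivity))).intervalIntegrable _ _)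
    (by
      have : Measurable fun θ : ℝ => fderiv ℂ q (x₀ + circleMap 0 R θ • v) :=
        (measurable_fderiv ℂ q).comp (by fun_prop : Continuous fun θ : ℝ =>
          x₀ + circleMap 0 R θ • v).measurable
      exact this.aestronglyMeasurable)
    (Eventually.of_forall fun θ _ x hx => hbd x hx θ)
    (continuous_const.intervalIntegrable _ _)
    (Eventually.of_forall fun θ _ x hx => by
      have := (hdiff x hx θ).hasFDerivAt
      exact (hasFDerivAt_comp_add_right _).2 this)
  rw [hfun]
  exact (key.differentiableAt).const_smul (2 * Real.pi)⁻¹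

theorem exists_entire_prod_div {n : ℕ} (Q : Finset (Fin n × Fin n)) (hQ : ∀ x ∈ Q, x.1 < x.2)
    {N : (Fin n → ℂ) → ℂ} (hN : Differentiable ℂ N)
    (h0 : ∀ x ∈ Q, ∀ s : Fin n → ℂ, s x.1 = s x.2 → N s = 0) :
    ∃ G : (Fin n → ℂ) → ℂ, Differentiable ℂ G ∧ ∀ s, N s = (∏ x ∈ Q, (s x.2 - s x.1)) * G s := by
  classical
  induction Q using Finset.induction_on with
  | empty => exact ⟨N, hN, by simp⟩
  | insert x Q hx ih =>
    obtain ⟨G, hG, hNG⟩ := ih (fun y hy => hQ y (Finset.mem_insert_of_mem hy))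
      (fun y hy => h0 y (Finset.mem_insert_of_mem hy))
    have hxlt := hQ x (Finset.mem_insert_self _ _)
    have hG0 : ∀ s : Fin n → ℂ, s x.1 = s x.2 → G s = 0 := by
      intro s hs
      set v : Fin n → ℂ := fun i => ((if i = x.2 then (x.1 : ℕ) else (i : ℕ) : ℕ) : ℂ) with hv
      refine eq_of_eq_along (G := fun _ => 0) hG.continuous continuous_const s v ?_
      filter_upwards [eventually_sep s v] with e he
      have hz : N (fun i => s i + e * v i) = 0 := by
        refine h0 x (Finset.mem_insert_self _ _) _ ?_
        simp [hv, hs]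
      rw [hNG] at hz
      refine (mul_eq_zero.1 hz).resolve_left ?_
      refine Finset.prod_ne_zero_iff.2 ?_
      intro y hy
      refine sub_ne_zero.2 (he _ _ ?_)
      intro hvy
      have hylt := hQ y (Finset.mem_insert_of_mem hy)
      have hne : y ≠ x := fun h => hx (h ▸ hy)
      simp only [hv, Nat.cast_inj] at hvy
      apply hne
      have := hylt
      have := hxlt
      rw [Prod.ext_iff]
      simp only [Fin.ext_iff, Fin.lt_def] at *
      split_ifs at hvy <;> omega
    obtain ⟨q, hq, hGq⟩ := exists_entire_div hG
      (ContinuousLinearMap.proj (R := ℂ) (φ := fun _ : Fin n => ℂ) x.2 -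
        ContinuousLinearMap.proj (R := ℂ) (φ := fun _ : Fin n => ℂ) x.1) (Pi.single x.2 1)
      (by simp [hxlt.ne])
      (fun s hs => hG0 s (by
        simp only [_root_.sub_apply, ContinuousLinearMap.proj_apply] at hs
        exact (sub_eq_zero.1 hs).symm))
    refine ⟨q, hq, fun s => ?_⟩
    rw [hNG, hGq, Finset.prod_insert hx]
    simp only [_root_.sub_apply, ContinuousLinearMap.proj_apply]
    ring

namespace OrdComp
variable {n p : ℕ}

theorem mem_young {c : OrdComp n p} {w : Equiv.Perm (Fin n)} :
    w ∈ c.young ↔ ∀ i, c.1 (w i) = c.1 i := by simp [young]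

theorem mul_mem_young {c : OrdComp n p} {u w : Equiv.Perm (Fin n)} (hu : u ∈ c.young)
    (hw : w ∈ c.young) : u * w ∈ c.young := by
  rw [mem_young] at *
  intro i
  rw [Equiv.Perm.mul_apply, hu, hw]

theorem inv_mem_young {c : OrdComp n p} {w : Equiv.Perm (Fin n)} (hw : w ∈ c.young) :
    w⁻¹ ∈ c.young := by
  rw [mem_young] at *
  intro i
  rw [← hw (w⁻¹ i), ← Equiv.Perm.mul_apply, mul_inv_cancel, Equiv.Perm.one_apply]

theorem young_subset_merge (c : OrdComp n (p + 1)) (ν : Fin p) :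
    c.young ⊆ (c.merge ν).young := by
  intro w hw
  rw [mem_young] at *
  intro i
  simp only [merge, hw i]

theorem eq_one_of_monotone_blocks {c : OrdComp n p} {w : Equiv.Perm (Fin n)} (hw : w ∈ c.young)
    (h : ∀ i j, i < j → c.1 i = c.1 j → w i < w j) : w = 1 := by
  rw [mem_young] at hw
  have hmono : Monotone w := by
    intro i j hij
    rcases hij.eq_or_lt with rfl | hlt
    · exact le_rfl
    by_cases hc : c.1 i = c.1 j
    · exact (h i j hlt hc).le
    · by_contra hcon
      have h1 := c.2.1 (not_le.1 hcon).le
      rw [hw, hw] at h1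
      exact hc (le_antisymm (c.2.1 hij) h1)
  exact (Equiv.Perm.monotone_iff w).1 hmono

theorem sum_young_merge (c : OrdComp n (p + 1)) (ν : Fin p) (T : Equiv.Perm (Fin n) → ℂ)
    (hT : ∀ w, ∀ h ∈ c.young, T (w * h) = T w) :
    ∑ w ∈ (c.merge ν).young, T w = (c.young.card : ℂ) * ∑ w ∈ c.shuffles ν, T w := by
  have h1 : ∑ x ∈ c.shuffles ν ×ˢ c.young, T (x.1 * x.2) = ∑ w ∈ (c.merge ν).young, T w := by
    refine Finset.sum_nbij (fun x => x.1 * x.2) ?_ ?_ ?_ (fun _ _ => rfl)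
    · rintro ⟨u, h⟩ hx
      rw [Finset.mem_product] at hx
      exact mul_mem_young (Finset.mem_filter.1 hx.1).1 (young_subset_merge c ν hx.2)
    · rintro ⟨u, h⟩ hx ⟨u', h'⟩ hx' heq
      simp only [Finset.coe_product, Set.mem_prod, Finset.mem_coe] at hx hx'
      simp only at heq
      have hk : h * h'⁻¹ ∈ c.young := mul_mem_young hx.2 (inv_mem_young hx'.2)
      have hu : u' = u * (h * h'⁻¹) := by rw [← mul_assoc, heq]; group
      have hone : h * h'⁻¹ = 1 := by
        refine eq_one_of_monotone_blocks hk fun i j hij hc => ?_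
        have h2 := (Finset.mem_filter.1 hx'.1).2 i j hij hc
        rw [hu, Equiv.Perm.mul_apply u, Equiv.Perm.mul_apply u] at h2
        by_contra hcon
        rcases (not_lt.1 hcon).eq_or_lt with he | hl
        · rw [he] at h2; exact lt_irrefl _ h2
        · refine lt_asymm h2 ((Finset.mem_filter.1 hx.1).2 _ _ hl ?_)
          rw [mem_young.1 hk, mem_young.1 hk, hc]
      rw [hone, mul_one] at hu
      rw [Prod.mk.injEq]
      exact ⟨hu.symm, mul_inv_eq_one.1 hone⟩
    · intro w hw
      rw [Finset.mem_coe, mem_young] at hw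
      set key : Fin n → Fin (p + 1) ×ₗ Fin n := fun i => toLex (c.1 i, w i) with hkey
      set σ := Tuple.sort key with hσ
      have hm : Monotone (key ∘ σ) := Tuple.monotone_sort key
      have hcm : Monotone (c.1 ∘ σ) := fun i j hij => by
        have := hm hij
        simp only [hkey, Function.comp_apply, Prod.Lex.toLex_le_toLex] at this
        rcases this with h | h
        · exact h.le
        · exact h.1.le
      have hcσ : σ ∈ c.young := by
        rw [mem_young]
        have := Tuple.unique_monotone (f := c.1) (σ := σ) (τ := 1) hcm (by simpa using c.2.1)
        intro i
        simpa using congrFun this i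
      refine ⟨(w * σ, σ⁻¹), ?_, by simp⟩
      simp only [Finset.coe_product, Set.mem_prod, Finset.mem_coe]
      refine ⟨Finset.mem_filter.2 ⟨mul_mem_young (mem_young.2 hw)
        (young_subset_merge c ν hcσ), fun i j hij hc => ?_⟩, inv_mem_young hcσ⟩
      have := hm hij.le
      simp only [hkey, Function.comp_apply, Prod.Lex.toLex_le_toLex, mem_young.1 hcσ, hc,
        lt_irrefl, false_or, true_and] at this
      exact lt_of_le_of_ne this fun he => hij.ne (σ.injective (w.injective he))
  rw [← h1, Finset.sum_product, Finset.mul_sum]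
  refine Finset.sum_congr rfl fun u _ => ?_
  rw [Finset.sum_congr rfl (fun h hh => hT u h hh), Finset.sum_const, nsmul_eq_mul]

end OrdComp

theorem shuffleTerm_mul {n p : ℕ} (lam : ℂ → ℂ) (c : OrdComp n (p + 1)) (ν : Fin p)
    (F : blockEntire c) (s : Fin n → ℂ) (w h : Equiv.Perm (Fin n)) (hh : h ∈ c.young) :
    shuffleTerm lam c ν F.1 s (w * h) = shuffleTerm lam c ν F.1 s w := by
  unfold shuffleTerm
  congr 1
  · exact F.2.2 h hh (fun i => s (w i))
  · refine Finset.prod_equiv (Equiv.prodCongr h h) (fun x => ?_) (fun x _ => rfl)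
    have := OrdComp.mem_young.1 hh
    simp [OrdComp.crossPairs, this]

theorem shuffleSum_perm {n p : ℕ} (lam : ℂ → ℂ) (c : OrdComp n (p + 1)) (ν : Fin p)
    (F : blockEntire c) (s : Fin n → ℂ) (v : Equiv.Perm (Fin n)) (hv : v ∈ (c.merge ν).young) :
    shuffleSum lam c ν F.1 (fun i => s (v i)) = shuffleSum lam c ν F.1 s := by
  have hcard : (c.young.card : ℂ) ≠ 0 := by
    rw [Nat.cast_ne_zero]
    exact Finset.card_ne_zero_of_mem (a := 1) (OrdComp.mem_young.2 fun i => rfl)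
  refine mul_left_cancel₀ hcard ?_
  unfold shuffleSum
  rw [← OrdComp.sum_young_merge c ν _ (fun w h hh => shuffleTerm_mul lam c ν F _ w h hh),
    ← OrdComp.sum_young_merge c ν _ (fun w h hh => shuffleTerm_mul lam c ν F _ w h hh)]
  refine Finset.sum_nbij' (fun w => v * w) (fun w => v⁻¹ * w)
    (fun w hw => OrdComp.mul_mem_young hv hw)
    (fun w hw => OrdComp.mul_mem_young (OrdComp.inv_mem_young hv) hw)
    (by simp) (by simp) (fun w _ => rfl)

theorem vandermonde_perm {n : ℕ} (s : Fin n → ℂ) (w : Equiv.Perm (Fin n)) :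
    ∏ x ∈ Finset.univ.filter (fun x : Fin n × Fin n => x.1 < x.2), (s (w x.2) - s (w x.1)) =
      (Equiv.Perm.sign w : ℤ) *
        ∏ x ∈ Finset.univ.filter (fun x : Fin n × Fin n => x.1 < x.2), (s x.2 - s x.1) := by
  have hV : ∀ s : Fin n → ℂ, (Matrix.vandermonde s).det =
      ∏ x ∈ Finset.univ.filter (fun x : Fin n × Fin n => x.1 < x.2), (s x.2 - s x.1) := by
    intro s
    rw [Matrix.det_vandermonde, Finset.prod_filter, Fintype.prod_prod_type]
    refine Finset.prod_congr rfl fun i _ => ?_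
    rw [← Finset.prod_filter]
    refine Finset.prod_congr ?_ fun _ _ => rfl
    ext; simp
  rw [← hV, ← hV (fun i => s (w i)), ← Matrix.det_permute]
  rfl

/-- The symmetric shuffle product of entire functions extends to an entire function. -/
theorem exists_entire_shuffle {n p : ℕ} {lam : ℂ → ℂ} (hlam : HasOnlySimplePoleAtZero lam)
    (c : OrdComp n (p + 1)) (ν : Fin p) (F : blockEntire c) :
    ∃ G : blockEntire (c.merge ν),
      ∀ s : Fin n → ℂ, Function.Injective s → G.1 s = shuffleSum lam c ν F.1 s := by
  classical
  obtain ⟨mu, hmu, hlm⟩ := exists_entire_numerator hlam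
  set L : Finset (Fin n × Fin n) := Finset.univ.filter fun x => x.1 < x.2 with hL
  have hPL : c.crossPairs ν ⊆ L := by
    intro x hx
    simp only [OrdComp.crossPairs, Finset.mem_filter, Finset.mem_univ, true_and] at hx
    simp only [hL, Finset.mem_filter, Finset.mem_univ, true_and]
    by_contra hcon
    have := c.2.1 (not_lt.1 hcon)
    rw [hx.1, hx.2] at this
    exact absurd this (not_le.2 (Fin.castSucc_lt_succ))
  set N : (Fin n → ℂ) → ℂ := fun s => ∑ w ∈ c.shuffles ν, F.1 (fun i => s (w i)) *
    ((Equiv.Perm.sign w : ℤ) * ((∏ x ∈ L \ c.crossPairs ν, (s (w x.2) - s (w x.1))) *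
      ∏ x ∈ c.crossPairs ν, -mu (s (w x.1) - s (w x.2)))) with hN
  have hNd : Differentiable ℂ N := by
    have hF := F.2.1
    have h1 : ∀ w : Equiv.Perm (Fin n),
        Differentiable ℂ fun s : Fin n → ℂ => F.1 (fun i => s (w i)) := fun w =>
      hF.comp (by fun_prop)
    have h2 : ∀ (w : Equiv.Perm (Fin n)) (x : Fin n × Fin n),
        Differentiable ℂ fun s : Fin n → ℂ => -mu (s (w x.1) - s (w x.2)) := fun w x =>
      (hmu.comp (by fun_prop)).neg
    rw [hN]
    fun_prop
  have hNA : ∀ s : Fin n → ℂ, Function.Injective s →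
      N s = (∏ x ∈ L, (s x.2 - s x.1)) * shuffleSum lam c ν F.1 s := by
    intro s hs
    simp only [hN, shuffleSum, Finset.mul_sum]
    refine Finset.sum_congr rfl fun w _ => ?_
    unfold shuffleTerm
    have hsgn : ((Equiv.Perm.sign w : ℤ) : ℂ) * (Equiv.Perm.sign w : ℤ) = 1 := by
      rw [← Int.cast_mul, ← Units.val_mul, Int.units_mul_self]; simp
    have hv : ∏ x ∈ L, (s x.2 - s x.1) =
        (Equiv.Perm.sign w : ℤ) * ∏ x ∈ L, (s (w x.2) - s (w x.1)) := by
      rw [hL, vandermonde_perm, ← mul_assoc, hsgn, one_mul]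
    rw [hv, ← Finset.prod_sdiff hPL]
    have hx : ∀ x ∈ c.crossPairs ν, -mu (s (w x.1) - s (w x.2)) =
        (s (w x.2) - s (w x.1)) * lam (s (w x.1) - s (w x.2)) := by
      intro x hx
      have hne : s (w x.1) - s (w x.2) ≠ 0 := by
        have hlt := hPL hx
        simp only [hL, Finset.mem_filter, Finset.mem_univ, true_and] at hlt
        exact sub_ne_zero.2 fun h => hlt.ne (w.injective (hs h))
      rw [hlm _ hne]
      field_simp
      ring
    rw [Finset.prod_congr rfl hx, Finset.prod_mul_distrib]
    ring
  have hNanti : ∀ v ∈ (c.merge ν).young, ∀ s : Fin n → ℂ,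
      N (fun i => s (v i)) = (Equiv.Perm.sign v : ℤ) * N s := by
    intro v hv s
    have := eq_of_eq_on_injective (F := fun s => N (fun i => s (v i)))
      (G := fun s => (Equiv.Perm.sign v : ℤ) * N s)
      (Continuous.comp (g := N) (f := fun (s : Fin n → ℂ) i => s (v i)) hNd.continuous
        (continuous_pi fun i => continuous_apply (v i))) (continuous_const.mul hNd.continuous) (by
        intro s hs
        have h1 := hNA (fun i => s (v i)) (hs.comp v.injective)
        rw [h1, hNA s hs, shuffleSum_perm lam c ν F s v hv, hL,
          vandermonde_perm]
        ring)
    exact congrFun this s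
  have hN0 : ∀ x ∈ L, ∀ s : Fin n → ℂ, s x.1 = s x.2 → N s = 0 := by
    intro x hx s hs
    simp only [hL, Finset.mem_filter, Finset.mem_univ, true_and] at hx
    by_cases hb : (c.merge ν).1 x.1 = (c.merge ν).1 x.2
    · have hsw : Equiv.swap x.1 x.2 ∈ (c.merge ν).young := by
        rw [OrdComp.mem_young]
        intro i
        by_cases h1 : i = x.1
        · rw [h1, Equiv.swap_apply_left, hb]
        by_cases h2 : i = x.2
        · rw [h2, Equiv.swap_apply_right, hb]
        rw [Equiv.swap_apply_of_ne_of_ne h1 h2]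
      have h1 := hNanti _ hsw s
      have h2 : (fun i => s (Equiv.swap x.1 x.2 i)) = s := by
        funext i
        by_cases h1 : i = x.1
        · rw [h1, Equiv.swap_apply_left, hs]
        by_cases h2 : i = x.2
        · rw [h2, Equiv.swap_apply_right, hs]
        rw [Equiv.swap_apply_of_ne_of_ne h1 h2]
      rw [h2, Equiv.Perm.sign_swap hx.ne] at h1
      simp only [Units.val_neg, Units.val_one, Int.cast_neg, Int.cast_one] at h1
      have h3 : (2 : ℂ) * N s = 0 := by linear_combination h1
      simpa using h3
    · simp only [hN]
      refine Finset.sum_eq_zero fun w hw => ?_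
      have hwy := OrdComp.mem_young.1 (Finset.mem_filter.1 hw).1
      have hzero : ∏ x ∈ L \ c.crossPairs ν, (s (w x.2) - s (w x.1)) = 0 := by
        have hmem : ∀ a b : Fin n, a < b → (c.merge ν).1 a ≠ (c.merge ν).1 b →
            (a, b) ∈ L \ c.crossPairs ν := by
          intro a b hab hne
          rw [Finset.mem_sdiff]
          refine ⟨by simpa [hL] using hab, fun hmem => hne ?_⟩
          simp only [OrdComp.crossPairs, Finset.mem_filter, Finset.mem_univ, true_and] at hmem
          simp [OrdComp.merge, hmem.1, hmem.2]
        have hi : ∀ y, (c.merge ν).1 (w⁻¹ y) = (c.merge ν).1 y := fun y => by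
          rw [← hwy (w⁻¹ y), ← Equiv.Perm.mul_apply, mul_inv_cancel, Equiv.Perm.one_apply]
        have hne : w⁻¹ x.1 ≠ w⁻¹ x.2 := fun h => hx.ne (w⁻¹.injective h)
        rcases lt_or_gt_of_ne hne with h | h
        · exact Finset.prod_eq_zero (hmem _ _ h (by rwa [hi, hi])) (by simp [hs])
        · exact Finset.prod_eq_zero (hmem _ _ h (by rw [hi, hi]; exact Ne.symm hb)) (by simp [hs])
      rw [hzero]; ring
  obtain ⟨G, hG, hNG⟩ := exists_entire_prod_div L (fun x hx => (Finset.mem_filter.1 hx).2) hNd hN0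
  have hGA : ∀ s : Fin n → ℂ, Function.Injective s → G s = shuffleSum lam c ν F.1 s := by
    intro s hs
    have h1 := hNA s hs
    rw [hNG s] at h1
    refine mul_left_cancel₀ ?_ h1
    rw [Finset.prod_ne_zero_iff]
    intro x hx
    exact sub_ne_zero.2 fun h => (Finset.mem_filter.1 hx).2.ne' (hs h)
  refine ⟨⟨G, hG, fun w hw s => ?_⟩, hGA⟩
  have := eq_of_eq_on_injective (F := fun s => G (fun i => s (w i))) (G := G)
    (Continuous.comp (g := G) (f := fun (s : Fin n → ℂ) i => s (w i)) hG.continuous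
      (continuous_pi fun i => continuous_apply (w i))) hG.continuous (by
      intro s hs
      have h1 := hGA (fun i => s (w i)) (hs.comp w.injective)
      rw [h1, hGA s hs, shuffleSum_perm lam c ν F s w hw])
  exact congrFun this s

/-- The symmetric shuffle multiplication `⋆` applied to the tensor factors `ν` and `ν + 1`: the
unique entire function that is given by `shuffleSum` at all points with distinct coordinates. -/
noncomputable def starMap {n p : ℕ} {lam : ℂ → ℂ} (hlam : HasOnlySimplePoleAtZero lam)
    (c : OrdComp n (p + 1)) (ν : Fin p) : blockEntire c →ₗ[symEntire n] blockEntire (c.merge ν) where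
  toFun F := (exists_entire_shuffle hlam c ν F).choose
  map_add' F F' := by
    apply Subtype.ext
    refine eq_of_eq_on_injective (blockEntire_continuous _) (blockEntire_continuous _)
      fun s hs => ?_
    rw [(exists_entire_shuffle hlam c ν (F + F')).choose_spec s hs]
    change _ = (exists_entire_shuffle hlam c ν F).choose.1 s +
      (exists_entire_shuffle hlam c ν F').choose.1 s
    rw [(exists_entire_shuffle hlam c ν F).choose_spec s hs,
      (exists_entire_shuffle hlam c ν F').choose_spec s hs]
    simp only [shuffleSum, shuffleTerm, Submodule.coe_add, Pi.add_apply, add_mul,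
      Finset.sum_add_distrib]
  map_smul' r F := by
    apply Subtype.ext
    refine eq_of_eq_on_injective (blockEntire_continuous _) (blockEntire_continuous _)
      fun s hs => ?_
    rw [(exists_entire_shuffle hlam c ν (r • F)).choose_spec s hs]
    change _ = r.1 s * (exists_entire_shuffle hlam c ν F).choose.1 s
    rw [(exists_entire_shuffle hlam c ν F).choose_spec s hs, shuffleSum, shuffleSum,
      Finset.mul_sum]
    refine Finset.sum_congr rfl fun w _ => ?_
    change r.1 (fun i => s (w i)) * F.1 (fun i => s (w i)) * _ = _
    rw [r.2.2 w s, shuffleTerm, mul_assoc]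

theorem starMap_apply {n p : ℕ} {lam : ℂ → ℂ} (hlam : HasOnlySimplePoleAtZero lam)
    (c : OrdComp n (p + 1)) (ν : Fin p) (F : blockEntire c) (s : Fin n → ℂ)
    (hs : Function.Injective s) :
    (starMap hlam c ν F).1 s = shuffleSum lam c ν F.1 s :=
  (exists_entire_shuffle hlam c ν F).choose_spec s hs

/-- The differential of the completed bar complex, from degree `-(p+1)` to degree `-p`:
the alternating sum of the multiplications of neighbouring tensor factors,
`d(f₁ ⊗ ⋯ ⊗ f_{p+1}) = ∑_ν (-1)^ν f₁ ⊗ ⋯ ⊗ (f_ν ⋆ f_{ν+1}) ⊗ ⋯ ⊗ f_{p+1}`, `ν` counted from `0`. -/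
noncomputable def barD {lam : ℂ → ℂ} (hlam : HasOnlySimplePoleAtZero lam) (n p : ℕ) :
    barTerm n (p + 1) →ₗ[symEntire n] barTerm n p :=
  ∑ c : OrdComp n (p + 1), ∑ ν : Fin p, (-1 : ℤ) ^ (ν : ℕ) •
    (LinearMap.single (symEntire n) (fun c' : OrdComp n p => blockEntire c') (c.merge ν) ∘ₗ
      starMap hlam c ν ∘ₗ
      LinearMap.proj (R := symEntire n) (φ := fun c : OrdComp n (p + 1) => blockEntire c) c)

/-- Evaluation of symmetric functions at the point of `Symⁿ(ℂ)` given by `t`. -/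
noncomputable def evalAt {n : ℕ} (t : Fin n → ℂ) : symEntire n →ₐ[ℂ] ℂ :=
  (Pi.evalAlgHom ℂ (fun _ : Fin n → ℂ => ℂ) t).comp (symEntire n).val

/-- The residue field `𝒪_T = ℂ` of `Symⁿ(ℂ)` at the point `T = {t₁, …, t_n}`, an algebra over
`𝒪(ℂⁿ)^{𝔖_n}` through evaluation at `T`. -/
def ResidueAt {n : ℕ} (_t : Fin n → ℂ) : Type := ℂ

noncomputable instance {n : ℕ} (t : Fin n → ℂ) : Field (ResidueAt t) :=
  inferInstanceAs (Field ℂ)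

noncomputable instance {n : ℕ} (t : Fin n → ℂ) : Algebra (symEntire n) (ResidueAt t) :=
  (evalAt t).toRingHom.toAlgebra

/-- The term of degree `-p` of the fibre at `T` of the bar complex: base change to `𝒪_T` over the
ring of functions on `Symⁿ(ℂ)`. -/
abbrev barFibre {n : ℕ} (t : Fin n → ℂ) (p : ℕ) : Type :=
  ResidueAt t ⊗[symEntire n] barTerm n p

/-- The differential of the fibre at `T`, from degree `-(p+1)` to degree `-p`. -/
noncomputable def barFibreD {lam : ℂ → ℂ} (hlam : HasOnlySimplePoleAtZero lam) {n : ℕ}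
    (t : Fin n → ℂ) (p : ℕ) : barFibre t (p + 1) →ₗ[ResidueAt t] barFibre t p :=
  (barD hlam n p).baseChange (ResidueAt t)

/-- A wheel of length `m` for `lam`: distinct complex numbers `s₁, …, s_m` with
`lam (s₂ - s₁) = ⋯ = lam (s_m - s_{m-1}) = lam (s₁ - s_m) = 0`. A one-term sequence is never a wheel,
since `lam` has a pole at `0`; so `2 ≤ m`, and only values of `lam` away from `0` matter. -/
def IsWheel (lam : ℂ → ℂ) {m : ℕ} (s : Fin m → ℂ) : Prop :=
  2 ≤ m ∧ Function.Injective s ∧ ∀ i, lam (s (finRotate m i) - s i) = 0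

end ShuffleBar

/-!
The fibre at `T` is a finite-dimensional complex. An entire function with the symmetry of a
composition that vanishes on the orbit of `t` is a combination, with coefficients of the same
symmetry, of the symmetric functions `∏_i (t_j - s_i)` (`exists_eq_sum_symOrbitEq_smul`): modulo the
ideal generated by these functions, products of Lagrange polynomials split `1` into orthogonal
idempotents, and those not supported on the orbit are zero. Since interpolation also realizes all
values on the orbit, the term of degree `-p` of the fibre is the space of functions on ordered
partitions of `T` into `p` nonempty blocks. A pair of a composition and a shuffle is the same as an
ordered partition (`sum_shuffles`, by the uniqueness of stable sorting), so the differential becomes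
the alternating sum of the operations that join neighbouring blocks `A`, `B`, with the coefficient
`∏_{i ∈ A, j ∈ B} a i j`, where `a i j = lam (t_i - t_j)` (`fibreToWords_barFibreD`).

In the absence of wheels, every nonempty set `J` of indices has an element `m` with `a j m ≠ 0` for
all other `j ∈ J`, since otherwise one could walk around a cycle of zeros. Splitting `m` off at the
end of its block is then a contracting homotopy on the words whose first block is not `{m}`, up to
words in which fewer blocks follow that of `m` (`homotopy_mem_lowSpan`); hence these words span an
acyclic subcomplex (`exists_wordBarD_eq_of_dropHead`). The quotient by it is spanned by the words
with first block `{m}`; it is the complex of words on the remaining indices, shifted by one. By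
induction, the only cohomology is a line in the top length.
-/

namespace ShuffleBar

open scoped TensorProduct

/-! ### The bar complex of words of blocks -/

section Words

variable {k ι : Type*} [Field k]

/-- The vector space on all words `A₁ | ⋯ | A_p` of finite subsets of `ι`. -/
abbrev Words (k ι : Type*) [Field k] : Type _ := List (Finset ι) →₀ k

/-- A linear map sends the span of a set `S` of words into `N` as soon as it does so on words. -/
theorem map_mem_of_mem_supported {M : Type*} [AddCommGroup M] [Module k M]
    {S : Set (List (Finset ι))} {N : Submodule k M} (f : Words k ι →ₗ[k] M)
    (hf : ∀ w ∈ S, f (Finsupp.single w 1) ∈ N) {x : Words k ι}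
    (hx : x ∈ Finsupp.supported k k S) : f x ∈ N := by
  rw [Finsupp.supported_eq_span_single] at hx
  have : Submodule.span k ((fun i => Finsupp.single i (1 : k)) '' S) ≤ N.comap f := by
    rw [Submodule.span_le]
    rintro _ ⟨w, hw, rfl⟩
    exact hf w hw
  exact this hx

theorem eq_of_mem_supported {M : Type*} [AddCommGroup M] [Module k M]
    {S : Set (List (Finset ι))} (f g : Words k ι →ₗ[k] M)
    (hf : ∀ w ∈ S, f (Finsupp.single w 1) = g (Finsupp.single w 1)) {x : Words k ι}
    (hx : x ∈ Finsupp.supported k k S) : f x = g x :=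
  map_mem_of_mem_supported (N := ⊥) (f - g)
    (fun w hw => by simp [hf w hw]) hx |> fun h => by
      simpa [sub_eq_zero] using h

/-- Putting the block `A` in front of a word. -/
noncomputable def consBlock (A : Finset ι) : Words k ι →ₗ[k] Words k ι :=
  Finsupp.lmapDomain k k (List.cons A)

@[simp] theorem consBlock_single (A : Finset ι) (l : List (Finset ι)) (c : k) :
    consBlock A (Finsupp.single l c) = Finsupp.single (A :: l) c := by
  simp [consBlock]

variable [DecidableEq ι]

/-- The words on the index set `I`: lists of pairwise disjoint nonempty sets with union `I`. -/
def IsWord : Finset ι → List (Finset ι) → Prop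
  | I, [] => I = ∅
  | I, A :: l => A.Nonempty ∧ A ⊆ I ∧ IsWord (I \ A) l

/-- The span of the words of length `p` on `I`. -/
def wordSpan (k : Type*) [Field k] (I : Finset ι) (p : ℕ) : Submodule k (Words k ι) :=
  Finsupp.supported k k {w | IsWord I w ∧ w.length = p}

theorem single_mem_wordSpan {I : Finset ι} {w : List (Finset ι)} {p : ℕ} (hw : IsWord I w)
    (hp : w.length = p) (c : k) : Finsupp.single w c ∈ wordSpan k I p :=
  Finsupp.single_mem_supported k c ⟨hw, hp⟩

theorem IsWord.length_le_card {w : List (Finset ι)} :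
    ∀ {I : Finset ι}, IsWord I w → w.length ≤ I.card := by
  induction w with
  | nil => intro I _; simp
  | cons A l ih =>
    rintro I ⟨hA, hAI, hl⟩
    have h1 := ih hl
    have h2 := Finset.card_sdiff_add_card_eq_card hAI
    have h3 := hA.card_pos
    simp only [List.length_cons]
    omega

theorem wordSpan_eq_bot_of_card_lt {I : Finset ι} {p : ℕ} (h : I.card < p) :
    wordSpan k I p = ⊥ := by
  have : {w : List (Finset ι) | IsWord I w ∧ w.length = p} = ∅ := by
    ext w
    simp only [Set.mem_ofPred_eq, Set.mem_empty_iff_false, iff_false, not_and]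
    intro hw hp
    have := hw.length_le_card
    omega
  rw [wordSpan, this, Finsupp.supported_empty]

theorem wordSpan_zero_eq_bot {I : Finset ι} (h : I.Nonempty) : wordSpan k I 0 = ⊥ := by
  have : {w : List (Finset ι) | IsWord I w ∧ w.length = 0} = ∅ := by
    ext w
    simp only [Set.mem_ofPred_eq, Set.mem_empty_iff_false, iff_false, not_and]
    intro hw hp
    obtain rfl := List.length_eq_zero_iff.1 hp
    exact h.ne_empty hw
  rw [wordSpan, this, Finsupp.supported_empty]

theorem consBlock_mem {I A : Finset ι} {p : ℕ} (hA : A.Nonempty) (hAI : A ⊆ I) {x : Words k ι}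
    (hx : x ∈ wordSpan k (I \ A) p) : consBlock A x ∈ wordSpan k I (p + 1) := by
  refine map_mem_of_mem_supported _ ?_ hx
  rintro w ⟨hw, rfl⟩
  rw [consBlock_single]
  exact single_mem_wordSpan (I := I) (w := A :: w) ⟨hA, hAI, hw⟩ rfl 1

variable (a : ι → ι → k)

/-- The structure constant `∏_{i ∈ A, j ∈ B} a i j` of the product of the blocks `A` and `B`. -/
def crossProd (A B : Finset ι) : k := ∏ i ∈ A, ∏ j ∈ B, a i j

theorem crossProd_union_left {A B : Finset ι} (h : Disjoint A B) (C : Finset ι) :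
    crossProd a (A ∪ B) C = crossProd a A C * crossProd a B C :=
  Finset.prod_union h

theorem crossProd_union_right (A : Finset ι) {B C : Finset ι} (h : Disjoint B C) :
    crossProd a A (B ∪ C) = crossProd a A B * crossProd a A C := by
  simp only [crossProd, Finset.prod_union h, Finset.prod_mul_distrib]

/-- Multiplying the first block of a word by `A` from the left. -/
noncomputable def mulHead (A : Finset ι) : Words k ι →ₗ[k] Words k ι :=
  Finsupp.linearCombination k fun
    | [] => 0
    | B :: l => Finsupp.single ((A ∪ B) :: l) (crossProd a A B)

@[simp] theorem mulHead_nil (A : Finset ι) (c : k) :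
    mulHead a A (Finsupp.single [] c) = 0 := by
  simp [mulHead]

@[simp] theorem mulHead_cons (A B : Finset ι) (l : List (Finset ι)) (c : k) :
    mulHead a A (Finsupp.single (B :: l) c) =
      Finsupp.single ((A ∪ B) :: l) (c * crossProd a A B) := by
  simp [mulHead]

theorem mulHead_consBlock (A B : Finset ι) (x : Words k ι) :
    mulHead a A (consBlock B x) = crossProd a A B • consBlock (A ∪ B) x := by
  induction x using Finsupp.induction_linear with
  | zero => simp
  | add x y hx hy => simp only [map_add, hx, hy, smul_add]
  | single l c => simp [mul_comm]

/-- The bar differential of a word, by recursion on its length: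
`d (A | l) = A ⋆ l - A | d l`, where `A ⋆ l` multiplies the first block of `l` by `A`. -/
noncomputable def wordD : List (Finset ι) → Words k ι
  | [] => 0
  | A :: l => mulHead a A (Finsupp.single l 1) - consBlock A (wordD l)

/-- The bar differential on the span of all words. -/
noncomputable def wordBarD : Words k ι →ₗ[k] Words k ι :=
  Finsupp.linearCombination k (wordD a)

@[simp] theorem wordBarD_nil (c : k) : wordBarD a (Finsupp.single [] c) = 0 := by
  simp [wordBarD, wordD]

theorem wordBarD_consBlock (A : Finset ι) (x : Words k ι) :
    wordBarD a (consBlock A x) = mulHead a A x - consBlock A (wordBarD a x) := by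
  induction x using Finsupp.induction_linear with
  | zero => simp
  | add x y hx hy => simp only [map_add, hx, hy]; abel
  | single l c =>
    rw [← mul_one c, ← smul_eq_mul, ← Finsupp.smul_single]
    simp only [map_smul, consBlock_single, ← smul_sub]
    simp [wordBarD, wordD]

theorem wordBarD_cons (A : Finset ι) (l : List (Finset ι)) (c : k) :
    wordBarD a (Finsupp.single (A :: l) c) =
      mulHead a A (Finsupp.single l c) - consBlock A (wordBarD a (Finsupp.single l c)) := by
  rw [← wordBarD_consBlock, consBlock_single]

theorem IsWord.union {I A B : Finset ι} {l : List (Finset ι)} (h : IsWord I (A :: B :: l)) :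
    IsWord I ((A ∪ B) :: l) := by
  obtain ⟨hA, hAI, hB, hBI, hl⟩ := h
  refine ⟨hA.mono Finset.subset_union_left,
    Finset.union_subset hAI (hBI.trans Finset.sdiff_subset), ?_⟩
  rwa [sdiff_sdiff_left, Finset.sup_eq_union] at hl

theorem IsWord.disjoint {I A B : Finset ι} {l : List (Finset ι)} (h : IsWord I (A :: B :: l)) :
    Disjoint A B :=
  (Finset.disjoint_of_subset_left h.2.2.2.1 Finset.sdiff_disjoint).symm

theorem mulHead_mem {I A : Finset ι} {p : ℕ} (hA : A.Nonempty) (hAI : A ⊆ I) {x : Words k ι}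
    (hx : x ∈ wordSpan k (I \ A) p) : mulHead a A x ∈ wordSpan k I p := by
  refine map_mem_of_mem_supported _ ?_ hx
  rintro w ⟨hw, rfl⟩
  cases w with
  | nil => simp
  | cons B l =>
    rw [mulHead_cons]
    exact single_mem_wordSpan (IsWord.union ⟨hA, hAI, hw⟩) rfl _

theorem wordBarD_mem {I : Finset ι} {p : ℕ} {x : Words k ι} (hx : x ∈ wordSpan k I (p + 1)) :
    wordBarD a x ∈ wordSpan k I p := by
  refine map_mem_of_mem_supported _ ?_ hx
  rintro w ⟨hw, hp⟩
  clear hx x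
  induction w generalizing I p with
  | nil => simp at hp
  | cons A l ih =>
    obtain ⟨hA, hAI, hl⟩ := hw
    simp only [List.length_cons, Nat.add_right_cancel_iff] at hp
    rw [wordBarD_cons]
    refine Submodule.sub_mem _ (mulHead_mem a hA hAI (single_mem_wordSpan hl hp 1)) ?_
    cases p with
    | zero =>
      obtain rfl := List.length_eq_zero_iff.1 hp
      simp
    | succ p => exact consBlock_mem hA hAI (ih hl hp)

/-- The square of the bar differential vanishes, by associativity of the product of blocks. -/
theorem wordBarD_wordBarD {I : Finset ι} {p : ℕ} {x : Words k ι} (hx : x ∈ wordSpan k I p) :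
    wordBarD a (wordBarD a x) = 0 := by
  refine eq_of_mem_supported (wordBarD a ∘ₗ wordBarD a) 0 ?_ hx
  rintro w ⟨hw, -⟩
  clear hx x
  simp only [LinearMap.comp_apply, LinearMap.zero_apply]
  induction w generalizing I with
  | nil => simp
  | cons A l ih =>
    rw [wordBarD_cons, map_sub, wordBarD_consBlock, ih hw.2.2, map_zero, sub_zero]
    cases l with
    | nil => simp
    | cons B l =>
      rw [mulHead_cons, wordBarD_cons, wordBarD_cons, map_sub, mulHead_consBlock, one_mul]
      rw [← mul_one (crossProd a A B), ← smul_eq_mul, ← Finsupp.smul_single]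
      simp only [map_smul, smul_eq_mul, mul_one]
      cases l with
      | nil => simp
      | cons C l =>
        have h1 := hw.disjoint
        have h2 := IsWord.disjoint hw.2.2
        simp only [mulHead_cons, one_mul, Finset.union_assoc, Finsupp.smul_single, smul_eq_mul,
          crossProd_union_left a h1, crossProd_union_right a A h2]
        rw [sub_sub_sub_cancel_right, ← Finsupp.single_sub,
          ← Finsupp.single_zero ((A ∪ (B ∪ C)) :: l)]
        congr 1
        ring

/-! ### The splitting homotopy -/

/-- The homotopy that splits `m` off at the end of its block:
`… | A | … ↦ ± a(A ∖ m, m)⁻¹ … | A ∖ m | m | …`, and `0` if the block of `m` is `{m}`. -/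
noncomputable def wordH (m : ι) : List (Finset ι) → Words k ι
  | [] => 0
  | A :: l =>
    if m ∈ A then
      if A = {m} then 0
      else Finsupp.single ((A.erase m) :: {m} :: l) (crossProd a (A.erase m) {m})⁻¹
    else - consBlock A (wordH m l)

/-- The linear extension of `wordH`. -/
noncomputable def splitH (m : ι) : Words k ι →ₗ[k] Words k ι :=
  Finsupp.linearCombination k (wordH a m)

/-- The linear map `{m} | l ↦ l`, and zero on words whose first block is not `{m}`. -/
noncomputable def dropHead (k : Type*) [Field k] (m : ι) : Words k ι →ₗ[k] Words k ι :=
  Finsupp.linearCombination k fun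
    | [] => 0
    | A :: l => if A = {m} then Finsupp.single l 1 else 0

@[simp] theorem splitH_nil (m : ι) (c : k) : splitH a m (Finsupp.single [] c) = 0 := by
  simp [splitH, wordH]

@[simp] theorem splitH_singleton (m : ι) (x : Words k ι) :
    splitH a m (consBlock {m} x) = 0 := by
  induction x using Finsupp.induction_linear with
  | zero => simp
  | add x y hx hy => simp only [map_add, hx, hy, add_zero]
  | single l c => simp [splitH, wordH]

theorem splitH_of_mem {m : ι} {A : Finset ι} (hm : m ∈ A) (hA : A ≠ {m}) (x : Words k ι) :
    splitH a m (consBlock A x) =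
      (crossProd a (A.erase m) {m})⁻¹ • consBlock (A.erase m) (consBlock {m} x) := by
  induction x using Finsupp.induction_linear with
  | zero => simp
  | add x y hx hy => simp only [map_add, hx, hy, smul_add]
  | single l c => simp [splitH, wordH, hm, hA, mul_comm]

theorem splitH_of_notMem {m : ι} {A : Finset ι} (hm : m ∉ A) (x : Words k ι) :
    splitH a m (consBlock A x) = - consBlock A (splitH a m x) := by
  induction x using Finsupp.induction_linear with
  | zero => simp
  | add x y hx hy => simp only [map_add, hx, hy, neg_add]
  | single l c => simp [splitH, wordH, hm]

@[simp] theorem dropHead_singleton (m : ι) (x : Words k ι) :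
    dropHead k m (consBlock {m} x) = x := by
  induction x using Finsupp.induction_linear with
  | zero => simp
  | add x y hx hy => simp only [map_add, hx, hy]
  | single l c => simp [dropHead]

theorem dropHead_of_ne {m : ι} {A : Finset ι} (hA : A ≠ {m}) (x : Words k ι) :
    dropHead k m (consBlock A x) = 0 := by
  induction x using Finsupp.induction_linear with
  | zero => simp
  | add x y hx hy => simp only [map_add, hx, hy, add_zero]
  | single l c => simp [dropHead, hA]

theorem dropHead_mem {I : Finset ι} {m : ι} {p : ℕ} {x : Words k ι}
    (hx : x ∈ wordSpan k I (p + 1)) : dropHead k m x ∈ wordSpan k (I.erase m) p := by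
  refine map_mem_of_mem_supported _ ?_ hx
  rintro w ⟨hw, hp⟩
  cases w with
  | nil => simp at hp
  | cons A l =>
    rw [← consBlock_single]
    by_cases hA : A = {m}
    · subst hA
      rw [dropHead_singleton]
      refine single_mem_wordSpan ?_ (by simpa using hp) 1
      rw [← Finset.sdiff_singleton_eq_erase]
      exact hw.2.2
    · rw [dropHead_of_ne hA]
      exact zero_mem _

theorem splitH_mem {I : Finset ι} {m : ι} {p : ℕ} {x : Words k ι}
    (hx : x ∈ wordSpan k I p) : splitH a m x ∈ wordSpan k I (p + 1) := by
  refine map_mem_of_mem_supported _ ?_ hx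
  rintro w ⟨hw, rfl⟩
  clear hx x
  induction w generalizing I with
  | nil => simp
  | cons A l ih =>
    obtain ⟨hA, hAI, hl⟩ := hw
    rw [← consBlock_single]
    by_cases hm : m ∈ A
    · by_cases hAm : A = {m}
      · subst hAm
        rw [splitH_singleton]
        exact zero_mem _
      · rw [splitH_of_mem a hm hAm]
        refine Submodule.smul_mem _ _ ?_
        simp only [consBlock_single]
        refine single_mem_wordSpan (I := I) (w := A.erase m :: {m} :: _)
          ⟨?_, (Finset.erase_subset _ _).trans hAI, by simp, ?_, ?_⟩ rfl 1
        · rw [Finset.nonempty_iff_ne_empty]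
          intro h
          rcases Finset.erase_eq_empty_iff A m |>.1 h with h | h
          · exact hA.ne_empty h
          · exact hAm h
        · simp [hAI hm]
        · convert hl using 1
          rw [sdiff_sdiff_left, Finset.sup_eq_union, Finset.union_comm,
            ← Finset.insert_eq, Finset.insert_erase hm]
    · rw [splitH_of_notMem a hm]
      exact Submodule.neg_mem _ (consBlock_mem hA hAI (ih hl))

theorem dropHead_splitH (m : ι) (x : Words k ι) : dropHead k m (splitH a m x) = 0 := by
  induction x using Finsupp.induction_linear with
  | zero => simp
  | add x y hx hy => simp only [map_add, hx, hy, add_zero]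
  | single w c =>
    cases w with
    | nil => simp
    | cons A l =>
      rw [← consBlock_single]
      by_cases hm : m ∈ A
      · by_cases hAm : A = {m}
        · subst hAm; rw [splitH_singleton, map_zero]
        · rw [splitH_of_mem a hm hAm, map_smul, dropHead_of_ne, smul_zero]
          intro h
          have := Finset.notMem_erase m A
          simp [h] at this
      · rw [splitH_of_notMem a hm, map_neg, dropHead_of_ne, neg_zero]
        rintro rfl
        simp at hm

theorem dropHead_mulHead {m : ι} {I A : Finset ι} {p : ℕ} {x : Words k ι} (hA : A.Nonempty)
    (hx : x ∈ wordSpan k (I \ A) p) :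
    dropHead k m (mulHead a A x) = 0 := by
  refine eq_of_mem_supported (dropHead k m ∘ₗ mulHead a A) 0 ?_ hx
  rintro w ⟨hw, -⟩
  simp only [LinearMap.comp_apply, LinearMap.zero_apply]
  cases w with
  | nil => simp
  | cons B l =>
    obtain ⟨hB, hBI, hl⟩ := hw
    rw [mulHead_cons, ← consBlock_single, dropHead_of_ne]
    intro h
    obtain ⟨b, hb⟩ := hB
    obtain ⟨c, hc⟩ := hA
    have h1 : b ∈ A ∪ B := Finset.mem_union_right _ hb
    have h2 : c ∈ A ∪ B := Finset.mem_union_left _ hc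
    rw [h, Finset.mem_singleton] at h1 h2
    have h3 := (Finset.mem_sdiff.1 (hBI hb)).2
    rw [h1, ← h2] at h3
    exact h3 hc

theorem dropHead_wordBarD {m : ι} {I : Finset ι} {p : ℕ} {x : Words k ι}
    (hx : x ∈ wordSpan k I p) :
    dropHead k m (wordBarD a x) = - wordBarD a (dropHead k m x) := by
  refine eq_of_mem_supported (dropHead k m ∘ₗ wordBarD a) (- (wordBarD a ∘ₗ dropHead k m)) ?_ hx
  rintro w ⟨hw, -⟩
  simp only [LinearMap.comp_apply, LinearMap.neg_apply]
  cases w with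
  | nil => simp [dropHead]
  | cons A l =>
    obtain ⟨hA, hAI, hl⟩ := hw
    rw [← consBlock_single, wordBarD_consBlock, map_sub,
      dropHead_mulHead a hA (single_mem_wordSpan hl rfl 1)]
    by_cases hAm : A = {m}
    · subst hAm; simp [-consBlock_single]
    · simp [dropHead_of_ne hAm, -consBlock_single]

/-- The number of blocks that follow the block of `m`. -/
def blocksAfter (m : ι) : List (Finset ι) → ℕ
  | [] => 0
  | A :: l => if m ∈ A then l.length else blocksAfter m l

/-- The span of the words in which fewer than `r` blocks follow the block of `m`. -/
def lowSpan (k : Type*) [Field k] (m : ι) (r : ℕ) : Submodule k (Words k ι) :=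
  Finsupp.supported k k {w | blocksAfter m w < r}

theorem single_mem_lowSpan {m : ι} {r : ℕ} {w : List (Finset ι)} (h : blocksAfter m w < r)
    (c : k) : Finsupp.single w c ∈ lowSpan k m r :=
  Finsupp.single_mem_supported k c h

theorem consBlock_mem_lowSpan {m : ι} {r : ℕ} {A : Finset ι} (hm : m ∉ A) {x : Words k ι}
    (hx : x ∈ lowSpan k m r) : consBlock A x ∈ lowSpan k m r := by
  refine map_mem_of_mem_supported _ (fun w hw => ?_) hx
  rw [consBlock_single]
  exact single_mem_lowSpan (by simpa [blocksAfter, hm] using hw) 1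

/-- If `m ∈ A`, then the words occurring in `h (A ⋆ l)` have fewer than `l.length` blocks after
the block of `m`. -/
theorem splitH_mulHead_mem_lowSpan {m : ι} {A : Finset ι} (hm : m ∈ A) (l : List (Finset ι)) :
    splitH a m (mulHead a A (Finsupp.single l 1)) ∈ lowSpan k m l.length := by
  cases l with
  | nil => simp
  | cons B l =>
    rw [mulHead_cons, ← consBlock_single]
    by_cases h : A ∪ B = {m}
    · rw [h, splitH_singleton]
      exact zero_mem _
    · rw [splitH_of_mem a (Finset.mem_union_left _ hm) h]
      refine Submodule.smul_mem _ _ ?_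
      simp only [consBlock_single]
      exact single_mem_lowSpan (by simp [blocksAfter]) _

/-- The homotopy commutes with `A ⋆ -` on words whose first block is not `{m}`. The only
interesting case is that of a first block `B ∋ m`, where `a(A, m)` cancels. -/
theorem splitH_mulHead_sub {m : ι} {I A : Finset ι} {l : List (Finset ι)}
    (hI : ∀ j ∈ I, j ≠ m → a j m ≠ 0) (hw : IsWord I (A :: l)) (hm : m ∉ A) :
    splitH a m (mulHead a A (Finsupp.single l 1)) - mulHead a A (splitH a m (Finsupp.single l 1)) =
      consBlock A (consBlock {m} (dropHead k m (Finsupp.single l 1))) := by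
  have hcross : ∀ C ⊆ I, m ∉ C → crossProd a C {m} ≠ 0 := fun C hC hmC =>
    Finset.prod_ne_zero_iff.2 fun j hj => by
      simpa using hI j (hC hj) fun h => hmC (h ▸ hj)
  cases l with
  | nil => simp [dropHead]
  | cons B l =>
    have hdis := hw.disjoint
    obtain ⟨hA, hAI, hB, hBI, hl⟩ := hw
    have hBI' : B ⊆ I := hBI.trans Finset.sdiff_subset
    rw [← consBlock_single B, mulHead_consBlock, map_smul]
    by_cases hmB : m ∈ B
    · have hne : A ∪ B ≠ {m} := by
        intro h
        obtain ⟨c, hc⟩ := hA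
        have h2 : c ∈ A ∪ B := Finset.mem_union_left _ hc
        rw [h, Finset.mem_singleton] at h2
        exact hm (h2 ▸ hc)
      rw [splitH_of_mem a (Finset.mem_union_right _ hmB) hne]
      by_cases hBm : B = {m}
      · subst hBm
        have he : (A ∪ {m}).erase m = A := by
          ext j; simp only [Finset.mem_erase, Finset.mem_union, Finset.mem_singleton]
          constructor
          · rintro ⟨h1, h2 | h2⟩
            · exact h2
            · exact absurd h2 h1
          · exact fun h => ⟨fun h' => hm (h' ▸ h), Or.inl h⟩
        rw [he, splitH_singleton, map_zero, sub_zero, dropHead_singleton, smul_smul,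
          mul_inv_cancel₀ (hcross A hAI hm), one_smul]
      · have he : (A ∪ B).erase m = A ∪ B.erase m := by
          rw [Finset.erase_union_distrib, Finset.erase_eq_of_notMem hm]
        have hAB : Disjoint A (B.erase m) :=
          Finset.disjoint_of_subset_right (Finset.erase_subset _ _) hdis
        have hB2 : crossProd a A B = crossProd a A (B.erase m) * crossProd a A {m} := by
          rw [← crossProd_union_right, Finset.union_comm, ← Finset.insert_eq,
            Finset.insert_erase hmB]
          simp
        rw [splitH_of_mem a hmB hBm, dropHead_of_ne hBm, map_zero, map_zero, map_smul,
          mulHead_consBlock, he, smul_smul, smul_smul, ← sub_smul, crossProd_union_left a hAB, hB2]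
        have h1 := hcross A hAI hm
        have h2 := hcross (B.erase m) ((Finset.erase_subset _ _).trans hBI')
          (Finset.notMem_erase _ _)
        have : crossProd a A (B.erase m) * crossProd a A {m} *
            (crossProd a A {m} * crossProd a (B.erase m) {m})⁻¹ -
            (crossProd a (B.erase m) {m})⁻¹ * crossProd a A (B.erase m) = 0 := by
          field_simp
          ring
        rw [this, zero_smul]
    · rw [splitH_of_notMem a (by simp [hm, hmB]), splitH_of_notMem a hmB, map_neg,
        mulHead_consBlock, dropHead_of_ne (by rintro rfl; simp at hmB)]
      simp

/-- Up to words with fewer blocks after the block of `m`, the map `d h + h d` is the projection onto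
the words whose first block is not `{m}`. -/
theorem homotopy_mem_lowSpan {m : ι} {I : Finset ι} {w : List (Finset ι)}
    (hI : ∀ j ∈ I, j ≠ m → a j m ≠ 0) (hmI : m ∈ I) (hw : IsWord I w) :
    wordBarD a (splitH a m (Finsupp.single w 1)) + splitH a m (wordBarD a (Finsupp.single w 1)) -
      (Finsupp.single w 1 - consBlock {m} (dropHead k m (Finsupp.single w 1))) ∈
      lowSpan k m (blocksAfter m w) := by
  induction w generalizing I with
  | nil =>
    rw [show I = ∅ from hw] at hmI
    simp at hmI
  | cons A l ih =>
    obtain ⟨hA, hAI, hl⟩ := hw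
    rw [← consBlock_single, wordBarD_consBlock]
    by_cases hm : m ∈ A
    · have hlow := splitH_mulHead_mem_lowSpan (k := k) a hm l
      have hafter : blocksAfter m (A :: l) = l.length := by simp [blocksAfter, hm]
      rw [hafter]
      by_cases hAm : A = {m}
      · subst hAm
        simpa [-consBlock_single] using hlow
      · have hmem : m ∉ A.erase m := Finset.notMem_erase m A
        have hα : crossProd a (A.erase m) {m} ≠ 0 :=
          Finset.prod_ne_zero_iff.2 fun j hj => by
            simpa using hI j (hAI (Finset.mem_of_mem_erase hj)) (Finset.ne_of_mem_erase hj)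
        have hins : A.erase m ∪ {m} = A := by
          rw [Finset.union_comm, ← Finset.insert_eq, Finset.insert_erase hm]
        have hlow2 : consBlock (A.erase m) (mulHead a {m} (Finsupp.single l 1)) ∈
            lowSpan k m l.length := by
          cases l with
          | nil => simp
          | cons B l =>
            rw [mulHead_cons]
            exact consBlock_mem_lowSpan hmem (single_mem_lowSpan (by simp [blocksAfter]) _)
        convert Submodule.sub_mem _ hlow
          (Submodule.smul_mem _ (crossProd a (A.erase m) {m})⁻¹ hlow2) using 1
        rw [splitH_of_mem a hm hAm, map_sub, splitH_of_mem a hm hAm, map_smul, wordBarD_consBlock,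
          wordBarD_consBlock, mulHead_consBlock, dropHead_of_ne hAm, hins]
        simp only [map_sub, smul_sub, smul_smul, inv_mul_cancel₀ hα, one_smul, map_zero]
        abel
    · have hafter : blocksAfter m (A :: l) = blocksAfter m l := by simp [blocksAfter, hm]
      rw [hafter]
      have h1 := ih (fun j hj => hI j (Finset.sdiff_subset hj)) (Finset.mem_sdiff.2 ⟨hmI, hm⟩) hl
      have h2 := splitH_mulHead_sub a hI ⟨hA, hAI, hl⟩ hm
      convert consBlock_mem_lowSpan hm h1 using 1
      rw [map_sub (splitH a m), splitH_of_notMem a hm, splitH_of_notMem a hm, map_neg,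
        wordBarD_consBlock, dropHead_of_ne (by rintro rfl; simp at hm)]
      simp only [map_sub, map_add, map_zero]
      rw [← h2]
      abel

/-- The complex of words whose first block is not `{m}` is acyclic. -/
theorem exists_wordBarD_eq_of_dropHead {m : ι} {I : Finset ι} {p : ℕ}
    (hI : ∀ j ∈ I, j ≠ m → a j m ≠ 0) (hmI : m ∈ I) {z : Words k ι} (hz : z ∈ wordSpan k I p)
    (hdz : wordBarD a z = 0) (hτ : dropHead k m z = 0) :
    ∃ y ∈ wordSpan k I (p + 1), dropHead k m y = 0 ∧ wordBarD a y = z := by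
  -- A cycle `z` is homologous to `z - d (h z)`, which lies one step lower in the filtration.
  have key : ∀ r, ∀ z ∈ wordSpan k I p, z ∈ lowSpan k m r → wordBarD a z = 0 →
      dropHead k m z = 0 →
      ∃ y ∈ wordSpan k I (p + 1), dropHead k m y = 0 ∧ wordBarD a y = z := by
    intro r
    induction r with
    | zero =>
      intro z _ hlow _ _
      have hz0 : z = 0 := by simpa [lowSpan] using hlow
      exact ⟨0, zero_mem _, map_zero _, by rw [map_zero, hz0]⟩
    | succ r ih =>
      intro z hz hlow hdz hτ
      have hh := splitH_mem a (m := m) hz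
      suffices hlow' : z - wordBarD a (splitH a m z) ∈ lowSpan k m r by
        obtain ⟨y, hy, hyτ, hyd⟩ := ih (z - wordBarD a (splitH a m z))
          (Submodule.sub_mem _ hz (wordBarD_mem a hh)) hlow'
          (by rw [map_sub, hdz, wordBarD_wordBarD a hh, sub_zero])
          (by rw [map_sub, hτ, dropHead_wordBarD a hh, dropHead_splitH, map_zero, neg_zero,
            sub_zero])
        exact ⟨y + splitH a m z, Submodule.add_mem _ hy hh,
          by rw [map_add, hyτ, dropHead_splitH, add_zero], by rw [map_add, hyd, sub_add_cancel]⟩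
      have hz' : z ∈ Finsupp.supported k k
          ({w | IsWord I w ∧ w.length = p} ∩ {w | blocksAfter m w < r + 1}) := by
        rw [Finsupp.supported_inter]
        exact ⟨hz, hlow⟩
      have := map_mem_of_mem_supported (N := lowSpan k m r)
        (wordBarD a ∘ₗ splitH a m + splitH a m ∘ₗ wordBarD a -
          (LinearMap.id - consBlock {m} ∘ₗ dropHead k m)) (fun w hw => ?_) hz'
      · rw [← Submodule.neg_mem_iff]
        simpa [hdz, hτ] using this
      · refine Finsupp.supported_mono ?_ (homotopy_mem_lowSpan a hI hmI hw.1.1)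
        intro v hv
        exact lt_of_lt_of_le hv (Nat.lt_succ_iff.1 hw.2)
  obtain ⟨r, hr⟩ : ∃ r, z ∈ lowSpan k m r := by
    refine ⟨z.support.sup (blocksAfter m) + 1, ?_⟩
    rw [lowSpan, Finsupp.mem_supported]
    intro w hw
    exact Nat.lt_succ_of_le (Finset.le_sup (f := blocksAfter m) hw)
  exact key r z hz hr hdz hτ

/-! ### Cohomology of the complex of words -/

/-- If every nonempty subset of `I` has an element `m` with `a j m ≠ 0` for all its other
elements `j`, then the complex of words on `I` is exact except in the top length. -/
theorem exists_wordBarD_eq (I : Finset ι)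
    (ha : ∀ J ⊆ I, J.Nonempty → ∃ m ∈ J, ∀ j ∈ J, j ≠ m → a j m ≠ 0) {p : ℕ} (hp : p < I.card)
    {z : Words k ι} (hz : z ∈ wordSpan k I p) (hdz : wordBarD a z = 0) :
    ∃ y ∈ wordSpan k I (p + 1), wordBarD a y = z := by
  induction I using Finset.strongInduction generalizing p z with
  | H I ih =>
    have hI : I.Nonempty := Finset.card_pos.1 (by omega)
    obtain ⟨m, hmI, hm⟩ := ha I subset_rfl hI
    cases p with
    | zero =>
      rw [wordSpan_zero_eq_bot hI, Submodule.mem_bot] at hz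
      exact ⟨0, zero_mem _, by simp [hz]⟩
    | succ p =>
      have hcard := Finset.card_erase_of_mem hmI
      obtain ⟨y, hy, hyd⟩ := ih (I.erase m) (Finset.erase_ssubset hmI)
        (fun J hJ => ha J (hJ.trans (Finset.erase_subset _ _))) (p := p) (by omega)
        (dropHead_mem (m := m) hz)
        (by rw [← neg_eq_zero, ← dropHead_wordBarD a hz, hdz, map_zero])
      rw [← Finset.sdiff_singleton_eq_erase] at hy
      have hmsub : {m} ⊆ I := by simpa using hmI
      have hcy : consBlock {m} y ∈ wordSpan k I (p + 2) :=
        consBlock_mem (by simp) hmsub hy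
      obtain ⟨y', hy', -, hyd'⟩ := exists_wordBarD_eq_of_dropHead a hm hmI
        (z := z + wordBarD a (consBlock {m} y)) (Submodule.add_mem _ hz (wordBarD_mem a hcy))
        (by rw [map_add, hdz, wordBarD_wordBarD a hcy, add_zero])
        (by rw [map_add, dropHead_wordBarD a hcy, dropHead_singleton, hyd, add_neg_cancel])
      exact ⟨y' - consBlock {m} y, Submodule.sub_mem _ hy' hcy, by rw [map_sub, hyd']; abel⟩

/-- Under the same condition on `a`, the cycles in the top length form a line. -/
theorem exists_wordBarD_ker_generator (I : Finset ι)
    (ha : ∀ J ⊆ I, J.Nonempty → ∃ m ∈ J, ∀ j ∈ J, j ≠ m → a j m ≠ 0) :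
    ∃ z ∈ wordSpan k I I.card, wordBarD a z = 0 ∧ z ≠ 0 ∧
      ∀ x ∈ wordSpan k I I.card, wordBarD a x = 0 → ∃ c : k, x = c • z := by
  induction I using Finset.strongInduction with
  | H I ih =>
    rcases I.eq_empty_or_nonempty with rfl | hI
    · refine ⟨Finsupp.single [] 1,
        single_mem_wordSpan (w := []) (show IsWord ∅ [] from rfl) rfl 1, by simp, by simp, ?_⟩
      intro x hx _
      refine ⟨x [], ?_⟩
      ext w
      rw [Finsupp.smul_apply, smul_eq_mul]
      cases w with
      | nil => simp
      | cons A l =>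
        have : x (A :: l) = 0 := by
          by_contra h
          have h2 := (Finsupp.mem_supported k x).1 hx (Finsupp.mem_support_iff.2 h)
          simpa using h2.2
        simp [this]
    · obtain ⟨m, hmI, hm⟩ := ha I subset_rfl hI
      obtain ⟨p, hp⟩ : ∃ p, I.card = p + 1 :=
        ⟨I.card - 1, by have := hI.card_pos; omega⟩
      have hcard : (I.erase m).card = p := by rw [Finset.card_erase_of_mem hmI, hp]; rfl
      obtain ⟨z', hz', hdz', hne, huniq⟩ := ih (I.erase m) (Finset.erase_ssubset hmI)
        (fun J hJ => ha J (hJ.trans (Finset.erase_subset _ _)))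
      rw [hcard] at hz' huniq
      rw [hp]
      have hmsub : {m} ⊆ I := by simpa using hmI
      have hz'' := hz'
      rw [← Finset.sdiff_singleton_eq_erase] at hz''
      have hcz : consBlock {m} z' ∈ wordSpan k I (p + 1) := consBlock_mem (by simp) hmsub hz''
      -- `{m} | z'` is a cycle up to words whose first block is not `{m}`, which can be corrected.
      obtain ⟨y, hy, hyτ, hyd⟩ := exists_wordBarD_eq_of_dropHead a hm hmI
        (wordBarD_mem a hcz) (wordBarD_wordBarD a hcz)
        (by rw [dropHead_wordBarD a hcz, dropHead_singleton, hdz', neg_zero])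
      have hτ : dropHead k m (consBlock {m} z' - y) = z' := by
        rw [map_sub, hyτ, dropHead_singleton, sub_zero]
      have hzmem := Submodule.sub_mem _ hcz hy
      have hzd : wordBarD a (consBlock {m} z' - y) = 0 := by rw [map_sub, hyd, sub_self]
      refine ⟨consBlock {m} z' - y, hzmem, hzd, ?_, ?_⟩
      · intro h
        rw [h, map_zero] at hτ
        exact hne hτ.symm
      · intro x hx hdx
        obtain ⟨c, hc⟩ := huniq (dropHead k m x) (dropHead_mem hx)
          (by rw [← neg_eq_zero, ← dropHead_wordBarD a hx, hdx, map_zero])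
        refine ⟨c, ?_⟩
        obtain ⟨u, hu, -, hud⟩ := exists_wordBarD_eq_of_dropHead a hm hmI
          (z := x - c • (consBlock {m} z' - y))
          (Submodule.sub_mem _ hx (Submodule.smul_mem _ _ hzmem))
          (by rw [map_sub, map_smul, hdx, hzd, smul_zero, sub_zero])
          (by rw [map_sub, map_smul, hτ, hc, sub_self])
        rw [wordSpan_eq_bot_of_card_lt (by omega), Submodule.mem_bot] at hu
        rw [hu, map_zero] at hud
        exact sub_eq_zero.1 hud.symm

end Words

/-! ### Entire functions vanishing on an orbit of distinct points -/

section Entire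

variable {n : ℕ}

/-- The ring of entire functions on `ℂⁿ`. -/
def entire (n : ℕ) : Subalgebra ℂ ((Fin n → ℂ) → ℂ) where
  carrier := {f | Differentiable ℂ f}
  mul_mem' := fun ha hb => ha.mul hb
  add_mem' := fun ha hb => ha.add hb
  algebraMap_mem' := fun r => differentiable_const r

/-- The coordinate functions on `ℂⁿ`. -/
def coord (i : Fin n) : entire n :=
  ⟨fun s => s i, by change Differentiable ℂ fun s : Fin n → ℂ => s i; fun_prop⟩

/-- Evaluation of entire functions at a point. -/
def evalPt (s : Fin n → ℂ) : entire n →ₐ[ℂ] ℂ :=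
  (Pi.evalAlgHom ℂ (fun _ : Fin n → ℂ => ℂ) s).comp (entire n).val

theorem evalPt_apply (s : Fin n → ℂ) (F : entire n) : evalPt s F = F.1 s := rfl

@[simp] theorem evalPt_coord (s : Fin n → ℂ) (i : Fin n) : evalPt s (coord i) = s i := rfl

theorem entire_ext {F G : entire n} (h : ∀ s, evalPt s F = evalPt s G) : F = G :=
  Subtype.ext (funext h)

/-- Hadamard's lemma: `F - F(b)` lies in the ideal of the functions `s_i - b_i`. -/
theorem exists_sub_eq_sum (F : entire n) (b : Fin n → ℂ) :
    ∃ G : Fin n → entire n,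
      F - algebraMap ℂ (entire n) (F.1 b) =
        ∑ i, (coord i - algebraMap ℂ (entire n) (b i)) * G i := by
  -- The coordinates are replaced by those of `b` one at a time.
  have key : ∀ Q : Finset (Fin n), ∃ G : Fin n → entire n, ∀ s : Fin n → ℂ,
      F.1 s - F.1 (Q.piecewise b s) = ∑ i ∈ Q, (s i - b i) * (G i).1 s := by
    intro Q
    induction Q using Finset.induction_on with
    | empty => exact ⟨fun _ => 0, by simp⟩
    | insert i Q hi ih =>
      obtain ⟨G, hG⟩ := ih
      have hF : Differentiable ℂ F.1 := F.2
      have hpw : ∀ Q : Finset (Fin n),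
          Differentiable ℂ fun s : Fin n → ℂ => Q.piecewise b (s + b) := by
        intro Q
        rw [differentiable_pi]
        intro j
        by_cases hj : j ∈ Q
        · simp [hj]
        · simp only [hj, not_false_eq_true, Finset.piecewise_eq_of_notMem, Pi.add_apply]
          fun_prop
      obtain ⟨q, hq, hqe⟩ := exists_entire_div
        (f := fun s => F.1 (Q.piecewise b (s + b)) - F.1 ((insert i Q).piecewise b (s + b)))
        ((hF.comp (hpw Q)).sub (hF.comp (hpw (insert i Q))))
        (ContinuousLinearMap.proj (R := ℂ) (φ := fun _ : Fin n => ℂ) i) (Pi.single i 1) (by simp)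
        (by
          intro s hs
          have hs' : s i = 0 := hs
          rw [Finset.piecewise_insert, sub_eq_zero]
          refine congrArg F.1 (funext fun j => ?_)
          by_cases hj : j = i
          · subst hj; simp [hi, hs']
          · simp [Function.update_of_ne hj])
      refine ⟨Function.update G i ⟨fun s => q (s - b), hq.comp (by fun_prop)⟩, fun s => ?_⟩
      rw [Finset.sum_insert hi, Function.update_self]
      have h1 := hqe (s - b)
      have h2 : ∑ j ∈ Q, (s j - b j) *
          (Function.update G i ⟨fun s => q (s - b), hq.comp (by fun_prop)⟩ j).1 s =
          ∑ j ∈ Q, (s j - b j) * (G j).1 s := by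
        refine Finset.sum_congr rfl fun j hj => ?_
        rw [Function.update_of_ne (by rintro rfl; exact hi hj)]
      rw [h2, ← hG]
      simp only [sub_add_cancel, ContinuousLinearMap.proj_apply, Pi.sub_apply] at h1
      linear_combination h1
  obtain ⟨G, hG⟩ := key Finset.univ
  refine ⟨G, entire_ext fun s => ?_⟩
  have := hG s
  simp only [Finset.piecewise_univ] at this
  simp only [map_sub, map_sum, map_mul, AlgHom.commutes, Algebra.algebraMap_self,
    RingHom.id_apply, evalPt_apply]
  exact this

variable (t : Fin n → ℂ)

/-- The symmetric function `∏_i (t_j - s_i)`, which vanishes at `s = t`. -/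
noncomputable def orbitEq (j : Fin n) : entire n :=
  ∏ i, (algebraMap ℂ (entire n) (t j) - coord i)

theorem evalPt_orbitEq (j : Fin n) (s : Fin n → ℂ) :
    evalPt s (orbitEq t j) = ∏ i, (t j - s i) := by
  simp [orbitEq]

/-- The product over `i` of the Lagrange polynomials of the nodes `t` with value `1` at `t_{b(i)}`,
taken in the variable `s_i`. -/
noncomputable def lagrangeProd (b : Fin n → Fin n) : entire n :=
  ∏ i, Polynomial.aeval (coord i) (Lagrange.basis Finset.univ t (b i))

theorem evalPt_aeval (s : Fin n → ℂ) (i : Fin n) (P : Polynomial ℂ) :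
    evalPt s (Polynomial.aeval (coord i) P) = P.eval (s i) := by
  rw [← Polynomial.aeval_algHom_apply, evalPt_coord, Polynomial.coe_aeval_eq_eval]

theorem evalPt_lagrangeProd (b : Fin n → Fin n) (s : Fin n → ℂ) :
    evalPt s (lagrangeProd t b) = ∏ i, (Lagrange.basis Finset.univ t (b i)).eval (s i) := by
  simp only [lagrangeProd, map_prod, evalPt_aeval]

theorem lagrangeProd_apply_of_injective (ht : Function.Injective t) (b b' : Fin n → Fin n) :
    (lagrangeProd t b).1 (fun i => t (b' i)) = if b = b' then 1 else 0 := by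
  rw [← evalPt_apply, evalPt_lagrangeProd]
  split_ifs with h
  · subst h
    exact Finset.prod_eq_one fun i _ => Lagrange.eval_basis_self ht.injOn (Finset.mem_univ _)
  · obtain ⟨i, hi⟩ := Function.ne_iff.1 h
    exact Finset.prod_eq_zero (Finset.mem_univ i) (Lagrange.eval_basis_of_ne hi (Finset.mem_univ _))

theorem sum_lagrangeProd (ht : Function.Injective t) :
    ∑ b : Fin n → Fin n, lagrangeProd t b = 1 := by
  have h : ∀ i : Fin n, ∑ j, Polynomial.aeval (coord i) (Lagrange.basis Finset.univ t j) =
      (1 : entire n) := by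
    intro i
    rw [← map_sum, Lagrange.sum_basis ht.injOn ⟨i, Finset.mem_univ i⟩, map_one]
  simp only [lagrangeProd]
  rw [← Fintype.prod_sum fun i j => Polynomial.aeval (coord i) (Lagrange.basis Finset.univ t j),
    Finset.prod_congr rfl fun i _ => h i, Finset.prod_const_one]

/-- The ideal generated by the symmetric functions `orbitEq t j`. -/
noncomputable def orbitIdeal : Ideal (entire n) := Ideal.span (Set.range (orbitEq t))

/-- `∏_j (s_i - t_j)` lies in `orbitIdeal t`: Lagrange interpolation at `t` expresses the polynomial
`∏_j (x - t_j) - ∏_j (x - s_j)` through its values `-orbitEq t j`; put `x = s_i`. -/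
theorem aeval_nodal_mem (ht : Function.Injective t) (i : Fin n) :
    Polynomial.aeval (coord i) (Lagrange.nodal Finset.univ t) ∈ orbitIdeal t := by
  have : Polynomial.aeval (coord i) (Lagrange.nodal Finset.univ t) =
      ∑ j, (- Polynomial.aeval (coord i) (Lagrange.basis Finset.univ t j)) * orbitEq t j := by
    refine entire_ext fun s => ?_
    rw [map_sum, evalPt_aeval]
    simp only [map_mul, map_neg, evalPt_aeval, evalPt_orbitEq]
    have hdeg : (Lagrange.nodal Finset.univ t - Lagrange.nodal Finset.univ s).degree <
        (Finset.univ : Finset (Fin n)).card := by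
      have h := Polynomial.degree_sub_lt_left (p := Lagrange.nodal Finset.univ t)
        (q := Lagrange.nodal Finset.univ s) (by rw [Lagrange.degree_nodal, Lagrange.degree_nodal])
        Lagrange.nodal_ne_zero (by rw [Lagrange.nodal_monic.leadingCoeff,
          Lagrange.nodal_monic.leadingCoeff])
      rwa [Lagrange.degree_nodal] at h
    have h := congrArg (Polynomial.eval (s i)) (Lagrange.eq_interpolate ht.injOn hdeg)
    rw [Polynomial.eval_sub, Lagrange.eval_nodal_at_node (Finset.mem_univ i), sub_zero,
      Lagrange.interpolate_apply, Polynomial.eval_finsetSum] at h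
    rw [h]
    refine Finset.sum_congr rfl fun j _ => ?_
    rw [Polynomial.eval_mul, Polynomial.eval_C, Polynomial.eval_sub,
      Lagrange.eval_nodal_at_node (Finset.mem_univ j), Lagrange.eval_nodal]
    ring
  rw [this]
  exact Ideal.sum_mem _ fun j _ => Ideal.mul_mem_left _ _ (Ideal.subset_span ⟨j, rfl⟩)

theorem coord_sub_mul_lagrangeProd_mem (ht : Function.Injective t) (b : Fin n → Fin n)
    (i : Fin n) :
    (coord i - algebraMap ℂ (entire n) (t (b i))) * lagrangeProd t b ∈ orbitIdeal t := by
  rw [lagrangeProd, ← Finset.mul_prod_erase _ _ (Finset.mem_univ i), ← mul_assoc]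
  refine Ideal.mul_mem_right _ _ ?_
  have : (coord i - algebraMap ℂ (entire n) (t (b i))) *
      Polynomial.aeval (coord i) (Lagrange.basis Finset.univ t (b i)) =
      algebraMap ℂ (entire n) (Lagrange.nodalWeight Finset.univ t (b i)) *
        Polynomial.aeval (coord i) (Lagrange.nodal Finset.univ t) := by
    have hX : coord i - algebraMap ℂ (entire n) (t (b i)) =
        Polynomial.aeval (coord i) (Polynomial.X - Polynomial.C (t (b i))) := by simp
    rw [hX, ← Polynomial.aeval_C (coord i), ← map_mul, ← map_mul,
      Lagrange.basis_eq_prod_sub_inv_mul_nodal_div (Finset.mem_univ (b i)),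
      ← Lagrange.nodal_erase_eq_nodal_div (Finset.mem_univ (b i)),
      Lagrange.nodal_eq_mul_nodal_erase (Finset.mem_univ (b i))]
    congr 1
    ring
  rw [this]
  exact Ideal.mul_mem_left _ _ (aeval_nodal_mem t ht i)

/-- Modulo `orbitIdeal t`, the function `lagrangeProd t b` is an eigenvector of multiplication by
`F`, with eigenvalue the value of `F` at `t ∘ b`. -/
theorem mul_lagrangeProd_sub_mem (ht : Function.Injective t) (b : Fin n → Fin n) (F : entire n) :
    F * lagrangeProd t b - algebraMap ℂ (entire n) (F.1 fun i => t (b i)) * lagrangeProd t b ∈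
      orbitIdeal t := by
  obtain ⟨G, hG⟩ := exists_sub_eq_sum F fun i => t (b i)
  rw [← sub_mul, hG, Finset.sum_mul]
  refine Ideal.sum_mem _ fun i _ => ?_
  rw [mul_right_comm]
  exact Ideal.mul_mem_right _ _ (coord_sub_mul_lagrangeProd_mem t ht b i)

/-- If `b` is not a permutation, then some `orbitEq t j` does not vanish at `t ∘ b`. -/
theorem lagrangeProd_mem_of_not_surjective (ht : Function.Injective t) {b : Fin n → Fin n}
    (hb : ¬ Function.Surjective b) : lagrangeProd t b ∈ orbitIdeal t := by
  obtain ⟨j, hj⟩ := not_forall.1 hb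
  have h1 := mul_lagrangeProd_sub_mem t ht b (orbitEq t j)
  have h2 : orbitEq t j * lagrangeProd t b ∈ orbitIdeal t :=
    Ideal.mul_mem_right _ _ (Ideal.subset_span ⟨j, rfl⟩)
  have h3 := (Submodule.sub_mem_iff_right _ h2).1 h1
  have hne : (orbitEq t j).1 (fun i => t (b i)) ≠ 0 := by
    rw [← evalPt_apply, evalPt_orbitEq, Finset.prod_ne_zero_iff]
    exact fun i _ => sub_ne_zero.2 fun h => hj ⟨i, (ht h).symm⟩
  have h4 := Ideal.mul_mem_left _ (algebraMap ℂ (entire n)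
    ((orbitEq t j).1 (fun i => t (b i)))⁻¹) h3
  rwa [← mul_assoc, ← map_mul, inv_mul_cancel₀ hne, map_one, one_mul] at h4

/-- An entire function vanishing on the orbit of a point with distinct coordinates lies in the ideal
generated by the symmetric functions that vanish there. -/
theorem mem_orbitIdeal (ht : Function.Injective t) (F : entire n)
    (hF : ∀ w : Equiv.Perm (Fin n), F.1 (fun i => t (w i)) = 0) : F ∈ orbitIdeal t := by
  rw [← mul_one F, ← sum_lagrangeProd t ht, Finset.mul_sum]
  refine Ideal.sum_mem _ fun b _ => ?_
  by_cases hb : Function.Surjective b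
  · have h := mul_lagrangeProd_sub_mem t ht b F
    have h0 := hF (Equiv.ofBijective b (Finite.surjective_iff_bijective.1 hb))
    simp only [Equiv.ofBijective_apply] at h0
    rwa [h0, map_zero, zero_mul, sub_zero] at h
  · exact Ideal.mul_mem_left _ _ (lagrangeProd_mem_of_not_surjective t ht hb)

/-! ### Generators for the block-symmetric functions vanishing on the orbit -/

/-- `orbitEq t j` as an element of the ring of symmetric entire functions. -/
noncomputable def symOrbitEq (j : Fin n) : symEntire n :=
  ⟨(orbitEq t j).1, (orbitEq t j).2, fun w s => by
    rw [← evalPt_apply, ← evalPt_apply, evalPt_orbitEq, evalPt_orbitEq]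
    exact Equiv.prod_comp w fun i => t j - s i⟩

theorem evalAt_symOrbitEq (j : Fin n) : evalAt t (symOrbitEq t j) = 0 := by
  change (orbitEq t j).1 t = 0
  rw [← evalPt_apply, evalPt_orbitEq]
  exact Finset.prod_eq_zero (Finset.mem_univ j) (sub_self _)

/-- The average of an entire function over the Young subgroup of a composition. -/
noncomputable def youngAverage {p : ℕ} (c : OrdComp n p) (G : entire n) : blockEntire c :=
  ⟨fun s => (c.young.card : ℂ)⁻¹ * ∑ w ∈ c.young, G.1 fun i => s (w i), by
    have hG : Differentiable ℂ G.1 := G.2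
    have : ∀ w : Equiv.Perm (Fin n), Differentiable ℂ fun s : Fin n → ℂ => G.1 fun i => s (w i) :=
      fun w => hG.comp (by fun_prop)
    fun_prop, fun w hw s => by
    refine congrArg (fun x : ℂ => (c.young.card : ℂ)⁻¹ * x) ?_
    exact Finset.sum_nbij' (fun u => w * u) (fun u => w⁻¹ * u)
      (fun u hu => OrdComp.mul_mem_young hw hu)
      (fun u hu => OrdComp.mul_mem_young (OrdComp.inv_mem_young hw) hu)
      (by simp) (by simp) (fun u _ => rfl)⟩

theorem exists_eq_sum_symOrbitEq_smul (ht : Function.Injective t) {p : ℕ} (c : OrdComp n p)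
    (F : blockEntire c) (hF : ∀ w : Equiv.Perm (Fin n), F.1 (fun i => t (w i)) = 0) :
    ∃ G : Fin n → blockEntire c, F = ∑ j, symOrbitEq t j • G j := by
  have h := mem_orbitIdeal t ht ⟨F.1, F.2.1⟩ hF
  obtain ⟨G, hG⟩ := Ideal.mem_span_range_iff_exists_fun.1 h
  refine ⟨fun j => youngAverage c (G j), Subtype.ext (funext fun s => ?_)⟩
  have hcard : (c.young.card : ℂ) ≠ 0 := by
    rw [Nat.cast_ne_zero]
    exact Finset.card_ne_zero_of_mem (a := 1) (OrdComp.mem_young.2 fun i => rfl)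
  have hFs : ∀ s, F.1 s = ∑ j, (G j).1 s * (orbitEq t j).1 s := by
    intro s
    have := congrArg (evalPt s) hG
    rw [map_sum] at this
    exact this.symm
  have hsum : (∑ j, symOrbitEq t j • youngAverage c (G j) : blockEntire c).1 s =
      ∑ j, (orbitEq t j).1 s *
        ((c.young.card : ℂ)⁻¹ * ∑ w ∈ c.young, (G j).1 fun i => s (w i)) := by
    rw [Submodule.coe_sum, Finset.sum_apply]
    rfl
  rw [hsum]
  calc F.1 s = (c.young.card : ℂ)⁻¹ * ∑ w ∈ c.young, F.1 fun i => s (w i) := by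
        rw [Finset.sum_congr rfl fun w hw => F.2.2 w hw s, Finset.sum_const, nsmul_eq_mul,
          inv_mul_cancel_left₀ hcard]
    _ = (c.young.card : ℂ)⁻¹ * ∑ w ∈ c.young, ∑ j, (G j).1 (fun i => s (w i)) *
          (orbitEq t j).1 s := by
        congr 1
        refine Finset.sum_congr rfl fun w _ => ?_
        rw [hFs]
        exact Finset.sum_congr rfl fun j _ => congrArg _ ((symOrbitEq t j).2.2 w s)
    _ = _ := by
        rw [Finset.sum_comm, Finset.mul_sum]
        refine Finset.sum_congr rfl fun j _ => ?_
        rw [← Finset.sum_mul]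
        ring

end Entire

/-! ### Words and surjections -/

section Surjections

variable {k ι : Type*} [Field k] [DecidableEq ι]

theorem isWord_map_range {p : ℕ} {I : Finset ι} {g : ι → ℕ} (h1 : ∀ i ∈ I, g i < p)
    (h2 : ∀ ν < p, ∃ i ∈ I, g i = ν) :
    IsWord I ((List.range p).map fun ν => I.filter fun i => g i = ν) := by
  induction p generalizing I g with
  | zero =>
    refine Finset.eq_empty_of_forall_notMem fun i hi => ?_
    exact absurd (h1 i hi) (by omega)
  | succ p ih =>
    rw [List.range_succ_eq_map, List.map_cons, List.map_map]
    obtain ⟨i, hi, hgi⟩ := h2 0 (by omega)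
    refine ⟨⟨i, by simp [hi, hgi]⟩, Finset.filter_subset _ _, ?_⟩
    have hne : ∀ i ∈ I \ I.filter (fun i => g i = 0), i ∈ I ∧ g i ≠ 0 := by
      intro i hi
      simp only [Finset.mem_sdiff, Finset.mem_filter, not_and] at hi
      exact ⟨hi.1, hi.2 hi.1⟩
    convert ih (I := I \ I.filter (fun i => g i = 0)) (g := fun i => g i - 1)
      (fun i hi => by
        have := hne i hi
        have := h1 i this.1
        show g i - 1 < p
        omega)
      (fun ν hν => by
        obtain ⟨i, hi, hgi⟩ := h2 (ν + 1) (by omega)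
        exact ⟨i, by simp [hi, hgi], by simp [hgi]⟩) using 1
    refine List.map_congr_left fun ν _ => ?_
    ext i
    simp only [Function.comp_apply, Finset.mem_filter, Finset.mem_sdiff, not_and]
    constructor
    · rintro ⟨hi, h⟩
      exact ⟨⟨hi, fun _ => by omega⟩, by omega⟩
    · rintro ⟨⟨hi, h⟩, h'⟩
      have := h hi
      exact ⟨hi, by omega⟩

theorem IsWord.exists_eq_map_range {I : Finset ι} {w : List (Finset ι)} (hw : IsWord I w) :
    ∃ g : ι → ℕ, (∀ i ∈ I, g i < w.length) ∧ (∀ ν < w.length, ∃ i ∈ I, g i = ν) ∧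
      w = (List.range w.length).map fun ν => I.filter fun i => g i = ν := by
  induction w generalizing I with
  | nil =>
    rw [show I = ∅ from hw]
    exact ⟨fun _ => 0, by simp, by simp, by simp⟩
  | cons A l ih =>
    obtain ⟨hA, hAI, hl⟩ := hw
    obtain ⟨g, h1, h2, h3⟩ := ih hl
    refine ⟨fun i => if i ∈ A then 0 else g i + 1, fun i hi => ?_, fun ν hν => ?_, ?_⟩
    · by_cases hiA : i ∈ A
      · simp [hiA]
      · simpa [hiA] using h1 i (Finset.mem_sdiff.2 ⟨hi, hiA⟩)
    · rcases ν with _ | ν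
      · obtain ⟨i, hi⟩ := hA
        exact ⟨i, hAI hi, by simp [hi]⟩
      · obtain ⟨i, hi, hgi⟩ := h2 ν (by simpa using hν)
        rw [Finset.mem_sdiff] at hi
        exact ⟨i, hi.1, by simp [hi.2, hgi]⟩
    · rw [List.length_cons, List.range_succ_eq_map, List.map_cons, List.map_map]
      congr 1
      · ext i
        by_cases hiA : i ∈ A
        · simp [hiA, hAI hiA]
        · simp [hiA]
      · conv_lhs => rw [h3]
        refine List.map_congr_left fun ν _ => ?_
        ext i
        by_cases hiA : i ∈ A <;> simp [hiA]

/-- The sequence of blocks `b` with the blocks `ν` and `ν + 1` joined. -/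
def mergeAt (b : ℕ → Finset ι) (ν μ : ℕ) : Finset ι :=
  if μ < ν then b μ else if μ = ν then b μ ∪ b (μ + 1) else b (μ + 1)

theorem wordBarD_map_range (a : ι → ι → k) (p : ℕ) (b : ℕ → Finset ι) :
    wordBarD a (Finsupp.single ((List.range (p + 1)).map b) 1) =
      ∑ ν ∈ Finset.range p, Finsupp.single ((List.range p).map (mergeAt b ν))
        ((-1) ^ ν * crossProd a (b ν) (b (ν + 1))) := by
  induction p generalizing b with
  | zero => simp [wordBarD_cons]
  | succ p ih =>
    rw [List.range_succ_eq_map, List.map_cons, List.map_map, wordBarD_cons, ih,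
      Finset.sum_range_succ', sub_eq_add_neg, add_comm, map_sum, ← Finset.sum_neg_distrib]
    congr 1
    · refine Finset.sum_congr rfl fun ν _ => ?_
      rw [consBlock_single, ← Finsupp.single_neg, List.range_succ_eq_map, List.map_cons,
        List.map_map]
      congr 1
      · congr 1
        refine List.map_congr_left fun μ _ => ?_
        simp [mergeAt]
      · simp only [Function.comp_apply, Nat.succ_eq_add_one]
        ring
    · rw [List.range_succ_eq_map, List.map_cons, List.map_cons, List.map_map, List.map_map,
        mulHead_cons]
      simp only [Function.comp_apply, Nat.succ_eq_add_one, one_mul, pow_zero, zero_add]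
      congr 2

/-- Surjections of `Fin n` onto `Fin p`, i.e. ordered partitions of `Fin n` into `p` nonempty
blocks. -/
abbrev Surj (n p : ℕ) : Type := {g : Fin n → Fin p // Function.Surjective g}

variable {n p : ℕ}

/-- The block of `g` with the number `ν`. -/
def Surj.block (g : Surj n p) (ν : ℕ) : Finset (Fin n) :=
  Finset.univ.filter fun i => (g.1 i : ℕ) = ν

/-- The word of blocks of a surjection. -/
def Surj.word (g : Surj n p) : List (Finset (Fin n)) := (List.range p).map g.block

/-- The ordered partition in which the blocks `ν` and `ν + 1` are joined. -/
def Surj.merge (g : Surj n (p + 1)) (ν : Fin p) : Surj n p :=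
  ⟨fun i => ν.predAbove (g.1 i), (Fin.predAbove_surjective ν).comp g.2⟩

theorem Surj.block_merge (g : Surj n (p + 1)) (ν : Fin p) (μ : ℕ) :
    (g.merge ν).block μ = mergeAt g.block ν μ := by
  ext i
  have : ((ν.predAbove (g.1 i) : Fin p) : ℕ) =
      if (ν : ℕ) < (g.1 i : ℕ) then (g.1 i : ℕ) - 1 else (g.1 i : ℕ) := by
    simp only [Fin.predAbove, Fin.lt_def, Fin.val_castSucc]
    split_ifs <;> simp
  have h1 : i ∈ (g.merge ν).block μ ↔
      (if (ν : ℕ) < (g.1 i : ℕ) then (g.1 i : ℕ) - 1 else (g.1 i : ℕ)) = μ := by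
    rw [← this]
    exact ⟨fun h => (Finset.mem_filter.1 h).2, fun h => Finset.mem_filter.2 ⟨Finset.mem_univ i, h⟩⟩
  have h2 : ∀ κ, i ∈ g.block κ ↔ (g.1 i : ℕ) = κ := by simp [Surj.block]
  rw [h1, mergeAt]
  split_ifs <;> simp only [Finset.mem_union, h2] <;> omega

theorem wordBarD_word (a : Fin n → Fin n → k) (g : Surj n (p + 1)) :
    wordBarD a (Finsupp.single g.word 1) = ∑ ν : Fin p, Finsupp.single (g.merge ν).word
      ((-1) ^ (ν : ℕ) * crossProd a (g.block ν) (g.block (ν + 1))) := by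
  rw [Surj.word, wordBarD_map_range, ← Fin.sum_univ_eq_sum_range
    (fun ν => Finsupp.single ((List.range p).map (mergeAt g.block ν))
        ((-1) ^ ν * crossProd a (g.block ν) (g.block (ν + 1)))) p]
  refine Finset.sum_congr rfl fun ν _ => ?_
  rw [Surj.word]
  congr 1
  exact List.map_congr_left fun μ _ => (g.block_merge ν μ).symm

theorem Surj.word_injective : Function.Injective (Surj.word : Surj n p → _) := by
  intro g g' h
  refine Subtype.ext (funext fun i => ?_)
  have h1 := List.map_inj_left.1 h (g.1 i) (List.mem_range.2 (g.1 i).2)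
  have h2 : i ∈ g.block (g.1 i) := by simp [Surj.block]
  rw [h1] at h2
  simp only [Surj.block, Finset.mem_filter, Finset.mem_univ, true_and] at h2
  exact Fin.ext h2.symm

theorem Surj.range_word :
    Set.range (Surj.word : Surj n p → _) = {w | IsWord Finset.univ w ∧ w.length = p} := by
  ext w
  constructor
  · rintro ⟨g, rfl⟩
    refine ⟨?_, by simp [Surj.word]⟩
    refine isWord_map_range (g := fun i => (g.1 i : ℕ)) (fun i _ => (g.1 i).2) fun ν hν => ?_
    obtain ⟨i, hi⟩ := g.2 ⟨ν, hν⟩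
    exact ⟨i, Finset.mem_univ _, by rw [hi]⟩
  · rintro ⟨hw, rfl⟩
    obtain ⟨g, h1, h2, h3⟩ := hw.exists_eq_map_range
    refine ⟨⟨fun i => ⟨g i, h1 i (Finset.mem_univ i)⟩, fun ν => ?_⟩, ?_⟩
    · obtain ⟨i, -, hi⟩ := h2 ν ν.2
      exact ⟨i, Fin.ext hi⟩
    · conv_rhs => rw [h3]
      rfl

/-- The identification of functions on ordered partitions with combinations of words. -/
noncomputable def toWords (k : Type*) [Field k] (n p : ℕ) :
    (Surj n p → k) →ₗ[k] Words k (Fin n) :=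
  Finsupp.lmapDomain k k (Surj.word (n := n) (p := p)) ∘ₗ
    (Finsupp.linearEquivFunOnFinite k k (Surj n p)).symm.toLinearMap

theorem toWords_apply (φ : Surj n p → k) :
    toWords k n p φ = ∑ g, Finsupp.single g.word (φ g) := by
  rw [toWords, LinearMap.comp_apply, Finsupp.lmapDomain_apply, Finsupp.mapDomain,
    Finsupp.sum_fintype _ _ (by simp)]
  rfl

theorem toWords_injective : Function.Injective (toWords k n p) :=
  (Finsupp.mapDomain_injective Surj.word_injective).comp
    (Finsupp.linearEquivFunOnFinite k k (Surj n p)).symm.injective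

theorem range_toWords : LinearMap.range (toWords k n p) = wordSpan k Finset.univ p := by
  rw [toWords, LinearMap.range_comp, LinearEquiv.range, ← Finsupp.supported_univ,
    Finsupp.lmapDomain_supported, Set.image_univ, Surj.range_word, wordSpan]

/-! ### Shuffles and surjections -/

/-- The composition of `n` given by the block sizes of an ordered partition. -/
def Surj.sortComp (g : Surj n p) : OrdComp n p :=
  ⟨g.1 ∘ Tuple.sort g.1, Tuple.monotone_sort g.1, g.2.comp (Tuple.sort g.1).surjective⟩

/-- Transport of an ordered partition along a permutation. -/
def Surj.comp (g : Surj n p) (w : Equiv.Perm (Fin n)) : Surj n p :=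
  ⟨g.1 ∘ w, g.2.comp w.surjective⟩

/-- The ordered partition into consecutive blocks given by a composition. -/
def OrdComp.toSurj (c : OrdComp n p) : Surj n p := ⟨c.1, c.2.2⟩

/-- Pairs of a composition `c` and a shuffle of its blocks `ν`, `ν + 1`, such that joining these two
blocks gives the composition of `h`, correspond to the ordered partitions that give `h` when their
blocks `ν` and `ν + 1` are joined. -/
theorem sum_shuffles {M : Type*} [AddCommMonoid M] (ν : Fin p) (h : Surj n p)
    (T : OrdComp n (p + 1) → Equiv.Perm (Fin n) → M) :
    ∑ c : OrdComp n (p + 1), (if c.merge ν = h.sortComp then ∑ w ∈ c.shuffles ν, T c w else 0) =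
      ∑ g : Surj n (p + 1), if g.merge ν = h then
        T (g.comp (Tuple.sort h.1)).sortComp (Tuple.sort (g.comp (Tuple.sort h.1)).1) else 0 := by
  classical
  rw [← Finset.sum_filter, ← Finset.sum_filter,
    Finset.sum_sigma' (Finset.univ.filter fun c : OrdComp n (p + 1) => c.merge ν = h.sortComp)
      (fun c => c.shuffles ν) T]
  set σ := Tuple.sort h.1 with hσ
  have hh : ∀ x, h.sortComp.1 x = h.1 (σ x) := fun x => rfl
  have hsort : ∀ (c : OrdComp n (p + 1)), ∀ w ∈ c.shuffles ν,
      Tuple.sort ((c.toSurj.comp (w⁻¹ * σ⁻¹)).comp σ).1 = w := by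
    intro c w hw
    have he : ((c.toSurj.comp (w⁻¹ * σ⁻¹)).comp σ).1 = fun x => c.1 (w⁻¹ x) := by
      funext x
      simp [Surj.comp, OrdComp.toSurj]
    rw [he]
    symm
    -- Being increasing on the blocks is what characterizes the stable sorting permutation.
    rw [Tuple.eq_sort_iff]
    refine ⟨fun i j hij => by simpa using c.2.1 hij, fun i j hij hc => ?_⟩
    exact (Finset.mem_filter.1 hw).2 i j hij (by simpa using hc)
  have hcomp : ∀ (c : OrdComp n (p + 1)), ∀ w ∈ c.shuffles ν,
      ((c.toSurj.comp (w⁻¹ * σ⁻¹)).comp σ).sortComp = c := by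
    intro c w hw
    refine Subtype.ext (funext fun x => ?_)
    simp only [Surj.sortComp, Function.comp_apply, hsort c w hw]
    simp [Surj.comp, OrdComp.toSurj]
  refine Finset.sum_nbij'
    (fun x => x.1.toSurj.comp (x.2⁻¹ * σ⁻¹))
    (fun g => ⟨(g.comp σ).sortComp, Tuple.sort (g.comp σ).1⟩) ?_ ?_ ?_ ?_ ?_
  · rintro ⟨c, w⟩ hx
    simp only [Finset.mem_sigma, Finset.mem_filter, Finset.mem_univ, true_and] at hx ⊢
    obtain ⟨hc, hw⟩ := hx
    have hy := OrdComp.mem_young.1 (Finset.mem_filter.1 hw).1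
    refine Subtype.ext (funext fun x => ?_)
    have h1 := hy (w⁻¹ (σ⁻¹ x))
    rw [hc, hh, hh] at h1
    rw [show w (w⁻¹ (σ⁻¹ x)) = σ⁻¹ x by simp, show σ (σ⁻¹ x) = x by simp] at h1
    have h2 := congrFun (congrArg Subtype.val hc) (w⁻¹ (σ⁻¹ x))
    rw [hh, ← h1] at h2
    exact h2
  · intro g hg
    simp only [Finset.mem_sigma, Finset.mem_filter, Finset.mem_univ, true_and] at hg ⊢
    set w := Tuple.sort (g.comp σ).1 with hw
    have hg' : ∀ x, ν.predAbove (g.1 x) = h.1 x := fun x => congrFun (congrArg Subtype.val hg) x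
    have hcw : ∀ x, ((g.comp σ).sortComp.merge ν).1 x = h.1 (σ (w x)) := fun x => hg' _
    have hmon : h.1 ∘ ⇑(σ * w) = h.1 ∘ ⇑σ := by
      refine Tuple.unique_monotone ?_ (Tuple.monotone_sort h.1)
      intro i j hij
      have := ((g.comp σ).sortComp.merge ν).2.1 hij
      rwa [hcw, hcw] at this
    have hm : (g.comp σ).sortComp.merge ν = h.sortComp :=
      Subtype.ext (funext fun x => (hcw x).trans (congrFun hmon x))
    refine ⟨hm, Finset.mem_filter.2 ⟨OrdComp.mem_young.2 fun i => ?_, ?_⟩⟩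
    · rw [hm, hh, hh]
      exact congrFun hmon i
    · exact ((Tuple.eq_sort_iff (f := (g.comp σ).1) (σ := w)).1 hw).2
  · rintro ⟨c, w⟩ hx
    simp only [Finset.mem_sigma, Finset.mem_filter, Finset.mem_univ, true_and] at hx
    simp only [hsort c w hx.2, hcomp c w hx.2]
  · intro g _
    refine Subtype.ext (funext fun x => ?_)
    simp [Surj.comp, OrdComp.toSurj, Surj.sortComp]
  · rintro ⟨c, w⟩ hx
    simp only [Finset.mem_sigma, Finset.mem_filter, Finset.mem_univ, true_and] at hx
    simp only [hsort c w hx.2, hcomp c w hx.2]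

end Surjections

/-! ### The fibre of the bar complex as the complex of words -/

section Fibre

variable {n p : ℕ} (t : Fin n → ℂ)

/-- Evaluation of the components of the bar complex on the orbit of `t`: the value at the ordered
partition `g` is that of the component with the block sizes of `g` at any rearrangement of `t` that
lists the blocks of `g` in their order. -/
noncomputable def orbitEval (p : ℕ) :
    barTerm n p →ₗ[symEntire n] (Surj n p → ResidueAt t) where
  toFun F g := (F g.sortComp).1 fun i => t (Tuple.sort g.1 i)
  map_add' _ _ := rfl
  map_smul' r F := funext fun g => by
    change r.1 (fun i => t (Tuple.sort g.1 i)) * (F g.sortComp).1 (fun i => t (Tuple.sort g.1 i)) =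
      r.1 t * (F g.sortComp).1 (fun i => t (Tuple.sort g.1 i))
    rw [r.2.2 (Tuple.sort g.1) t]

theorem orbitEval_eq (F : barTerm n p) (g : Surj n p) (c : OrdComp n p)
    (w : Equiv.Perm (Fin n)) (hc : ∀ i, g.1 (w i) = c.1 i) :
    orbitEval t p F g = (F c).1 fun i => t (w i) := by
  have hcs : c = g.sortComp := by
    refine Subtype.ext ?_
    have h1 : g.1 ∘ w = c.1 := funext hc
    have h2 : Monotone (g.1 ∘ w) := h1 ▸ c.2.1
    rw [← h1]
    exact Tuple.unique_monotone h2 (Tuple.monotone_sort g.1)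
  subst hcs
  have h2 : ∀ x, Tuple.sort g.1 ((Tuple.sort g.1)⁻¹ x) = x := fun x => by simp
  have hy : (Tuple.sort g.1)⁻¹ * w ∈ g.sortComp.young := by
    rw [OrdComp.mem_young]
    intro i
    change g.1 (Tuple.sort g.1 ((Tuple.sort g.1)⁻¹ (w i))) = _
    rw [h2, hc]
  have := (F g.sortComp).2.2 _ hy fun i => t (Tuple.sort g.1 i)
  simp only [Equiv.Perm.mul_apply, h2] at this
  exact this.symm

/-- All values on the orbit occur: the component with index `c` is the sum over the permutations `w`
of `lagrangeProd t w`, weighted by the value prescribed at `t ∘ w`, which is constant on the cosets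
of the Young subgroup of `c`. -/
theorem orbitEval_surjective (ht : Function.Injective t) :
    Function.Surjective (orbitEval t p) := by
  intro φ
  let f : (c : OrdComp n p) → Equiv.Perm (Fin n) → ℂ := fun c w => φ (c.toSurj.comp w⁻¹)
  refine ⟨fun c => ⟨fun s => ∑ w : Equiv.Perm (Fin n), f c w * (lagrangeProd t w).1 s, ?_, ?_⟩, ?_⟩
  · have : ∀ b, Differentiable ℂ (lagrangeProd t b).1 := fun b => (lagrangeProd t b).2
    fun_prop
  · intro u hu s
    refine Fintype.sum_equiv (Equiv.mulRight u⁻¹) _ _ fun w => ?_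
    rw [Equiv.coe_mulRight]
    congr 1
    · simp only [f]
      congr 1
      refine Subtype.ext (funext fun x => ?_)
      have := OrdComp.mem_young.1 hu (w⁻¹ x)
      simpa [Surj.comp, OrdComp.toSurj] using this.symm
    · rw [← evalPt_apply, ← evalPt_apply, evalPt_lagrangeProd, evalPt_lagrangeProd]
      refine Fintype.prod_equiv u _ _ fun i => ?_
      simp
  · funext g
    change ∑ w : Equiv.Perm (Fin n), f g.sortComp w *
      (lagrangeProd t w).1 (fun i => t (Tuple.sort g.1 i)) = φ g
    rw [Finset.sum_eq_single (Tuple.sort g.1)]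
    · rw [lagrangeProd_apply_of_injective t ht, if_pos rfl, mul_one]
      simp only [f]
      congr 1
      refine Subtype.ext (funext fun x => ?_)
      simp [Surj.comp, OrdComp.toSurj, Surj.sortComp]
    · intro w _ hw
      rw [lagrangeProd_apply_of_injective t ht, if_neg fun h => hw (DFunLike.coe_injective h),
        mul_zero]
    · simp

/-- The fibre of the bar complex at the orbit of `t`, as functions on ordered partitions. -/
noncomputable def fibreEval (p : ℕ) :
    barFibre t p →ₗ[ResidueAt t] (Surj n p → ResidueAt t) :=
  (orbitEval t p).liftBaseChange (ResidueAt t)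

theorem residueAt_tmul_smul (z : ResidueAt t) (r : symEntire n) (F : barTerm n p) :
    z ⊗ₜ[symEntire n] (r • F) = (algebraMap (symEntire n) (ResidueAt t) r * z) ⊗ₜ[symEntire n] F :=
  ((TensorProduct.mk (symEntire n) (ResidueAt t) (barTerm n p) z).map_smul r F).trans
    ((TensorProduct.mk (symEntire n) (ResidueAt t) (barTerm n p)).map_smul₂ r z F).symm

theorem exists_eq_one_tmul (x : barFibre t p) : ∃ F : barTerm n p, x = 1 ⊗ₜ F := by
  induction x using TensorProduct.induction_on with
  | zero => exact ⟨0, (TensorProduct.tmul_zero _ _).symm⟩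
  | add x y hx hy =>
    obtain ⟨F, rfl⟩ := hx
    obtain ⟨G, rfl⟩ := hy
    exact ⟨F + G, (TensorProduct.tmul_add _ _ _).symm⟩
  | tmul r F =>
    refine ⟨algebraMap ℂ (symEntire n) r • F, ?_⟩
    rw [residueAt_tmul_smul]
    exact congrArg (· ⊗ₜ[symEntire n] F) (mul_one r).symm

theorem fibreEval_surjective (ht : Function.Injective t) : Function.Surjective (fibreEval t p) := by
  intro φ
  obtain ⟨F, rfl⟩ := orbitEval_surjective t ht φ
  exact ⟨1 ⊗ₜ F, by rw [fibreEval, LinearMap.liftBaseChange_one_tmul]⟩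

theorem fibreEval_injective (ht : Function.Injective t) : Function.Injective (fibreEval t p) := by
  rw [injective_iff_map_eq_zero]
  intro x hx
  obtain ⟨F, rfl⟩ := exists_eq_one_tmul t x
  rw [fibreEval, LinearMap.liftBaseChange_one_tmul] at hx
  have hF : ∀ c : OrdComp n p, ∃ G : Fin n → blockEntire c, F c = ∑ j, symOrbitEq t j • G j := by
    intro c
    refine exists_eq_sum_symOrbitEq_smul t ht c (F c) fun w => ?_
    rw [← orbitEval_eq t F (c.toSurj.comp w⁻¹) c w (fun i => by simp [Surj.comp, OrdComp.toSurj]),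
      hx]
    rfl
  choose G hG using hF
  have hsum : F = ∑ j, symOrbitEq t j • fun c => G c j := by
    funext c
    rw [hG, Finset.sum_apply]
    rfl
  rw [hsum, TensorProduct.tmul_sum]
  refine Finset.sum_eq_zero fun j _ => ?_
  rw [residueAt_tmul_smul, show algebraMap _ (ResidueAt t) (symOrbitEq t j) = 0 from
    evalAt_symOrbitEq t j, zero_mul, TensorProduct.zero_tmul]

variable {lam : ℂ → ℂ} (hlam : HasOnlySimplePoleAtZero lam)

theorem barD_apply (F : barTerm n (p + 1)) (c' : OrdComp n p) {s : Fin n → ℂ}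
    (hs : Function.Injective s) :
    (barD hlam n p F c').1 s = ∑ ν : Fin p, ∑ c : OrdComp n (p + 1),
      if c.merge ν = c' then (-1) ^ (ν : ℕ) * shuffleSum lam c ν (F c).1 s else 0 := by
  have h1 : barD hlam n p F c' = ∑ c : OrdComp n (p + 1), ∑ ν : Fin p, (-1 : ℤ) ^ (ν : ℕ) •
      (Pi.single (M := fun c' : OrdComp n p => blockEntire c') (c.merge ν)
        (starMap hlam c ν (F c)) c') := by
    simp only [barD, LinearMap.sum_apply, Finset.sum_apply]
    rfl
  rw [h1, Finset.sum_comm, Submodule.coe_sum, Finset.sum_apply]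
  refine Finset.sum_congr rfl fun ν _ => ?_
  rw [Submodule.coe_sum, Finset.sum_apply]
  refine Finset.sum_congr rfl fun c _ => ?_
  split_ifs with h
  · subst h
    rw [Pi.single_eq_same, ← starMap_apply hlam c ν (F c) s hs]
    rcases Nat.even_or_odd (ν : ℕ) with h | h
    · rw [h.neg_one_pow, h.neg_one_pow, one_smul, one_mul]
    · rw [h.neg_one_pow, h.neg_one_pow, neg_smul, one_smul, neg_one_mul]
      rfl
  · rw [Pi.single_eq_of_ne (Ne.symm h), smul_zero]
    rfl

/-- The matrix of the values `lam (t_i - t_j)`. -/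
def diffMatrix (lam : ℂ → ℂ) (t : Fin n → ℂ) (i j : Fin n) : ResidueAt t :=
  (lam (t i - t j) : ℂ)

theorem orbitEval_barD (ht : Function.Injective t) (F : barTerm n (p + 1)) (h : Surj n p) :
    orbitEval t p (barD hlam n p F) h = ∑ ν : Fin p, ∑ g : Surj n (p + 1),
      if g.merge ν = h then (-1) ^ (ν : ℕ) *
        crossProd (diffMatrix lam t) (g.block ν) (g.block (ν + 1)) * orbitEval t (p + 1) F g
      else 0 := by
  set σ := Tuple.sort h.1 with hσ
  refine (barD_apply hlam F h.sortComp (ht.comp σ.injective)).trans ?_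
  refine Finset.sum_congr rfl fun ν _ => ?_
  have h1 := sum_shuffles ν h fun c w =>
    (-1) ^ (ν : ℕ) * shuffleTerm lam c ν (F c).1 (fun i => t (σ i)) w
  simp only [← Finset.mul_sum] at h1
  refine h1.trans ?_
  refine Finset.sum_congr rfl fun g _ => ?_
  split_ifs with hg
  swap
  · rfl
  set w := Tuple.sort (g.comp σ).1 with hw
  have hgw : ∀ i, g.1 ((σ * w) i) = (g.comp σ).sortComp.1 i := fun i => rfl
  rw [orbitEval_eq t F g _ (σ * w) hgw, shuffleTerm]
  have hcross : crossProd (diffMatrix lam t) (g.block ν) (g.block (ν + 1)) =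
      ∏ x ∈ (g.comp σ).sortComp.crossPairs ν, lam (t (σ (w x.1)) - t (σ (w x.2))) := by
    rw [crossProd, ← Finset.prod_product']
    symm
    refine Finset.prod_equiv (Equiv.prodCongr (σ * w) (σ * w)) (fun x => ?_) fun x _ => rfl
    simp only [OrdComp.crossPairs, Finset.mem_filter, Finset.mem_univ, true_and, ← hgw,
      Finset.mem_product, Surj.block, Equiv.prodCongr_apply, Prod.map_fst, Prod.map_snd,
      Fin.ext_iff, Fin.val_castSucc, Fin.val_succ]
  rw [hcross]
  exact (congrArg _ (mul_comm _ _)).trans (mul_assoc _ _ _).symm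

/-- The fibre of the bar complex, as a subspace of the combinations of words. -/
noncomputable def fibreToWords (p : ℕ) :
    barFibre t p →ₗ[ResidueAt t] Words (ResidueAt t) (Fin n) :=
  toWords (ResidueAt t) n p ∘ₗ fibreEval t p

theorem fibreToWords_injective (ht : Function.Injective t) :
    Function.Injective (fibreToWords t p) :=
  toWords_injective.comp (fibreEval_injective t ht)

theorem range_fibreToWords (ht : Function.Injective t) :
    LinearMap.range (fibreToWords t p) = wordSpan (ResidueAt t) Finset.univ p := by
  rw [fibreToWords, LinearMap.range_comp_of_range_eq_top _
    (LinearMap.range_eq_top.2 (fibreEval_surjective t ht)), range_toWords]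

theorem fibreToWords_barFibreD (ht : Function.Injective t) (x : barFibre t (p + 1)) :
    fibreToWords t p (barFibreD hlam t p x) =
      wordBarD (diffMatrix lam t) (fibreToWords t (p + 1) x) := by
  obtain ⟨F, rfl⟩ := exists_eq_one_tmul t x
  rw [barFibreD, LinearMap.baseChange_tmul, fibreToWords, fibreToWords, LinearMap.comp_apply,
    LinearMap.comp_apply, fibreEval, fibreEval, LinearMap.liftBaseChange_one_tmul,
    LinearMap.liftBaseChange_one_tmul, toWords_apply, toWords_apply, map_sum]
  have h1 : ∀ g : Surj n (p + 1), wordBarD (diffMatrix lam t)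
      (Finsupp.single g.word (orbitEval t (p + 1) F g)) =
      ∑ ν : Fin p, Finsupp.single (g.merge ν).word ((-1) ^ (ν : ℕ) *
        crossProd (diffMatrix lam t) (g.block ν) (g.block (ν + 1)) *
          orbitEval t (p + 1) F g) := by
    intro g
    rw [← mul_one (orbitEval t (p + 1) F g), ← smul_eq_mul, ← Finsupp.smul_single, map_smul,
      wordBarD_word, Finset.smul_sum]
    refine Finset.sum_congr rfl fun ν _ => ?_
    rw [Finsupp.smul_single, smul_eq_mul, smul_eq_mul, mul_one, mul_comm]
  rw [Finset.sum_congr rfl fun g _ => h1 g, Finset.sum_comm,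
    Finset.sum_congr rfl fun h _ => congrArg (Finsupp.single h.word)
      (orbitEval_barD t hlam ht F h)]
  simp only [Finsupp.single_finsetSum]
  rw [Finset.sum_comm]
  refine Finset.sum_congr rfl fun ν _ => ?_
  rw [Finset.sum_comm]
  refine Finset.sum_congr rfl fun g _ => ?_
  rw [Finset.sum_eq_single (g.merge ν) (fun h _ hne => by rw [if_neg (Ne.symm hne),
    Finsupp.single_zero]) (by simp), if_pos rfl]

/-! ### Absence of wheels -/

/-- If no wheel lies in `t`, then every nonempty set `J` of indices has an element `m` with
`lam (t_j - t_m) ≠ 0` for all other `j ∈ J`: otherwise successive choices of `j` run into a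
cycle. -/
theorem exists_forall_ne_zero_of_no_wheel (ht : Function.Injective t)
    (hwheel : ∀ (m : ℕ) (s : Fin m → ℂ), IsWheel lam s → ¬ Set.range s ⊆ Set.range t)
    (J : Finset (Fin n)) (hJ : J.Nonempty) :
    ∃ m ∈ J, ∀ j ∈ J, j ≠ m → diffMatrix lam t j m ≠ 0 := by
  by_contra hcon
  push Not at hcon
  choose! f hfJ hne h0 using hcon
  have hmaps : ∀ k, ∀ i ∈ J, f^[k] i ∈ J := by
    intro k
    induction k with
    | zero => intro i hi; exact hi
    | succ k ih => intro i hi; exact ih (f i) (hfJ i hi)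
  obtain ⟨i₀, hi₀⟩ := hJ
  obtain ⟨a, b, hab, heq⟩ := Finite.exists_ne_map_eq_of_infinite fun k : ℕ => f^[k] i₀
  obtain ⟨x, hx, hper⟩ : ∃ x ∈ J, x ∈ Function.periodicPts f := by
    rcases lt_or_gt_of_ne hab with h | h
    · refine ⟨f^[a] i₀, hmaps a i₀ hi₀, b - a, by omega, ?_⟩
      change f^[b - a] (f^[a] i₀) = f^[a] i₀
      rw [← Function.iterate_add_apply, Nat.sub_add_cancel h.le]
      exact heq.symm
    · refine ⟨f^[b] i₀, hmaps b i₀ hi₀, a - b, by omega, ?_⟩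
      change f^[a - b] (f^[b] i₀) = f^[b] i₀
      rw [← Function.iterate_add_apply, Nat.sub_add_cancel h.le]
      exact heq
  set m := Function.minimalPeriod f x with hm
  have hpos : 0 < m := Function.minimalPeriod_pos_of_mem_periodicPts hper
  have hm1 : m ≠ 1 := by
    intro h
    have := Function.minimalPeriod_eq_one_iff_isFixedPt.1 h
    exact hne x hx this
  refine hwheel m (fun k => t (f^[k] x)) ⟨by omega, ?_, ?_⟩ ?_
  · intro k l hkl
    exact Fin.ext (Function.iterate_injOn_Iio_minimalPeriod k.2 l.2 (ht hkl))
  · obtain ⟨m', hm'⟩ : ∃ m', m = m' + 1 := ⟨m - 1, by omega⟩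
    intro k
    have h1 : f^[(finRotate m k : Fin m)] x = f (f^[k] x) := by
      rw [← Function.iterate_succ_apply' f]
      clear_value m
      subst hm'
      by_cases hk : k = Fin.last m'
      · subst hk
        rw [finRotate_last]
        simp only [Fin.val_zero, Fin.val_last]
        rw [Nat.succ_eq_add_one, hm, Function.iterate_minimalPeriod]
        rfl
      · rw [coe_finRotate_of_ne_last hk]
    change lam (t (f^[(finRotate m k : Fin m)] x) - t (f^[k] x)) = 0
    rw [h1]
    exact h0 _ (hmaps k x hx)
  · rintro _ ⟨k, rfl⟩
    exact ⟨_, rfl⟩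

end Fibre
end ShuffleBar

theorem mainTheorem3 (lam : ℂ → ℂ) (hlam : ShuffleBar.HasOnlySimplePoleAtZero lam)
    (n : ℕ) (t : Fin n → ℂ) (ht : Function.Injective t)
    (hwheel : ∀ (m : ℕ) (s : Fin m → ℂ), ShuffleBar.IsWheel lam s →
      ¬ Set.range s ⊆ Set.range t) :
    (∀ q : ℕ, q + 1 < n →
      Function.Exact (ShuffleBar.barFibreD hlam t (q + 1)) (ShuffleBar.barFibreD hlam t q)) ∧
    (∀ q : ℕ, q + 1 = n →
      Module.finrank (ShuffleBar.ResidueAt t)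
        (LinearMap.ker (ShuffleBar.barFibreD hlam t q)) = 1) := by
  have ha : ∀ J ⊆ (Finset.univ : Finset (Fin n)), J.Nonempty →
      ∃ m ∈ J, ∀ j ∈ J, j ≠ m → ShuffleBar.diffMatrix lam t j m ≠ 0 := fun J _ hJ =>
    ShuffleBar.exists_forall_ne_zero_of_no_wheel t ht hwheel J hJ
  have hmem : ∀ {p : ℕ} (x : ShuffleBar.barFibre t p), ShuffleBar.fibreToWords t p x ∈
      ShuffleBar.wordSpan (ShuffleBar.ResidueAt t) Finset.univ p := fun x => by
    rw [← ShuffleBar.range_fibreToWords t ht]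
    exact LinearMap.mem_range_self _ x
  have hex : ∀ {p : ℕ} {y}, y ∈ ShuffleBar.wordSpan (ShuffleBar.ResidueAt t) Finset.univ p →
      ∃ x : ShuffleBar.barFibre t p, ShuffleBar.fibreToWords t p x = y := fun {p y} hy => by
    rw [← ShuffleBar.range_fibreToWords t ht] at hy
    exact hy
  have hinj : ∀ {p : ℕ}, Function.Injective (ShuffleBar.fibreToWords t p) :=
    fun {_} _ _ h => ShuffleBar.fibreToWords_injective t ht h
  refine ⟨fun q hq x => ⟨fun hx => ?_, ?_⟩, fun q hq => ?_⟩
  · obtain ⟨y, hy, hyx⟩ := ShuffleBar.exists_wordBarD_eq (ShuffleBar.diffMatrix lam t) Finset.univ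
      ha (by simpa using hq) (hmem x)
      (by rw [← ShuffleBar.fibreToWords_barFibreD t hlam ht, hx, map_zero])
    obtain ⟨z, rfl⟩ := hex hy
    exact ⟨z, hinj (by rw [ShuffleBar.fibreToWords_barFibreD t hlam ht, hyx])⟩
  · rintro ⟨z, rfl⟩
    refine hinj ?_
    rw [ShuffleBar.fibreToWords_barFibreD t hlam ht, ShuffleBar.fibreToWords_barFibreD t hlam ht,
      ShuffleBar.wordBarD_wordBarD _ (hmem z), map_zero]
  · obtain ⟨z, hz, hdz, hne, huniq⟩ := ShuffleBar.exists_wordBarD_ker_generator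
      (ShuffleBar.diffMatrix lam t) Finset.univ ha
    have hcard : (Finset.univ : Finset (Fin n)).card = q + 1 := by simp [hq]
    rw [hcard] at hz huniq
    obtain ⟨v, rfl⟩ := hex hz
    have hv : v ∈ LinearMap.ker (ShuffleBar.barFibreD hlam t q) := by
      refine LinearMap.mem_ker.2 (hinj ?_)
      rw [ShuffleBar.fibreToWords_barFibreD t hlam ht, hdz, map_zero]
    let f : ShuffleBar.ResidueAt t →ₗ[ShuffleBar.ResidueAt t]
        LinearMap.ker (ShuffleBar.barFibreD hlam t q) :=
      LinearMap.toSpanSingleton _ _ ⟨v, hv⟩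
    have hf : ∀ c, ShuffleBar.fibreToWords t (q + 1) (f c).1 =
        c • ShuffleBar.fibreToWords t (q + 1) v := fun c => map_smul _ c v
    have hbij : Function.Bijective f := by
      refine ⟨fun c c' h => smul_left_injective _ hne ?_, ?_⟩
      · change c • _ = c' • _
        rw [← hf, ← hf, h]
      · rintro ⟨u, hu⟩
        obtain ⟨c, hc⟩ := huniq _ (hmem u)
          (by rw [← ShuffleBar.fibreToWords_barFibreD t hlam ht, LinearMap.mem_ker.1 hu, map_zero])
        exact ⟨c, Subtype.ext (hinj (by rw [hf, hc]))⟩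
    rw [← (LinearEquiv.ofBijective f hbij).finrank_eq, Module.finrank_self]
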